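/- **Setting.** Let $N=2^n$ oscillators sit on the vertices $\mathcal V=\{0,1\}^n$ of a simple graph $\mathcal G$, with masses $m_u>0$, wall spring constants $\kappa_u\ge 0$ and coupling constants $\kappa_{uv}=\kappa_{vu}>0$ on the edges. Let $M=\mathrm{diag}(m_u)$, let $K$ be the stiffness matrix ($K_{uu}=\kappa_u+\sum_{w\sim u}\kappa_{wu}$, $K_{uv}=-\kappa_{uv}$ on edges, $0$ otherwise), and $H=M^{-1/2}KM^{-1/2}$, $\|H\|_{\max}=\max_{u,v}|H_{uv}|$. Let every closed neighbourhood of $\mathcal G$ have at most $s$ elements (so that $H$ is $s$-sparse), and let $\tilde N[u]\subseteq\mathcal V$ be the closed neighbourhood of $u$ enlarged by dummy vertices to exactly $s$ elements. Let $W$ be an orthogonal matrix with $W^{T}HW=\mathrm{diag}(\lambda_j)$. For an oscillator $u$ let $\Lambda_u=\{\lambda_j: W_{uj}^2>0\}$, $N_u=|\Lambda_u|$, let $w_u(\lambda)=\sum_{j:\lambda_j=\lambda}W_{uj}^2$ be the weight of $\lambda\in\Lambda_u$ (weights of a degenerate eigenvalue are gathered), and let $\Delta^{(u)}_\lambda$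 be the smallest distance between two different elements of $\Lambda_u$ (we assume $N_u\ge2$, so that it exists). **Oracles.** $H$ is accessed through unitaries $O_P$ and $O_\vartheta$ and their inverses, where $$O_P|u\rangle|0\rangle^{\otimes n}=\tfrac1{\sqrt s}\sum_{v\in\tilde N[u]}|u\rangle|v\rangle,\qquad O_\vartheta|u,v\rangle|0\rangle^{\otimes (r+1)}=|u,v\rangle|\vartheta_{uv},\Theta(-H_{uv})\rangle$$ for all $u,v\in\mathcal V$, with $\Theta(x)=1$ for $x>0$ and $\Theta(x)=0$ otherwise; here $\vartheta_{uv}=\arccos\sqrt{|H_{uv}|/\|H\|_{\max}}$ is represented exactly by $r$ bits in a fixed, known format (for instance as $\frac{\pi}{2}$ times a binary fraction). **Quantum query algorithm.** A circuit of fixed unitaries, interleaved with queries to $O_P,O_P^\dagger,O_\vartheta,O_\vartheta^\dagger$, is started in the all-zero state, measured in the computational basis, and run independently a fixed number of times; the output is a function of the measured bit strings. The queries are counted over all the runs. **Theorem.** There is an absolute constant $C>0$ such that the following holds for all $\varepsilon>0$ and $\delta,\zeta\in(0,1)$. There is a quantum query algorithm, which depends only on $n$, $s$, $u$, $\|H\|_{\max}$,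 $\Delta_\lambda^{(u)}$, $N_u$, $\varepsilon$, $\delta$, $\zeta$ and the format of the $r$-bit angle register (and not otherwise on the network or the oracles), that outputs a finite list of pairs $(\tilde\lambda,\tilde w)$ which, for every such network and all such oracles, with probability at least $1-\zeta$ is accurate in the following sense: the entries of the list correspond to distinct eigenvalues $\lambda\in\Lambda_u$, with $|\tilde\lambda-\lambda|\le\varepsilon$ and $|\tilde w-w_u(\lambda)|\le\delta$; and each $\lambda\in\Lambda_u$ that is not in the list, i.e. whose weight is estimated by $0$, has $w_u(\lambda)\le\delta$. Besides the $r+1$ qubits of the angle and sign registers of $O_\vartheta$, the algorithm uses at most $$C\log_2\!\Big(Ns\|H\|_{\max}\max\Big(\frac1\varepsilon,\frac1{\delta\Delta^{(u)}_\lambda}\Big)\Big)$$ qubits, and in total at most $$C\,\frac{s\|H\|_{\max}}{\delta^2}\,\ln\!\Big(\frac{N_u}{\zeta}\Big)\max\Big(\frac1\varepsilon,\frac1{\delta\Delta^{(u)}_\lambda}\Big)$$ oracle queries. -/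

import Mathlib

open scoped Matrix Kronecker

namespace ResponseQPE

/-! ### Networks of coupled oscillators -/

/-- A network of coupled harmonic oscillators on a simple graph: masses, springs to a common wall
and coupling springs on the edges. The values of `spring` off the edges are irrelevant. -/
structure OscillatorNetwork (V : Type) where
  graph : SimpleGraph V
  mass : V → ℝ
  wall : V → ℝ
  spring : V → V → ℝ
  mass_pos : ∀ u, 0 < mass u
  wall_nonneg : ∀ u, 0 ≤ wall u
  spring_symm : ∀ u v, spring u v = spring v u
  spring_pos : ∀ u v, graph.Adj u v → 0 < spring u v

namespace OscillatorNetwork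

variable {V : Type} [Fintype V] [DecidableEq V]

open Classical in
/-- The stiffness matrix `K`. -/
noncomputable def stiffness (S : OscillatorNetwork V) : Matrix V V ℝ :=
  Matrix.of fun u v =>
    if u = v then S.wall u + ∑ w with S.graph.Adj u w, S.spring w u
    else if S.graph.Adj u v then -S.spring u v
    else 0

/-- `M^{-1/2}` for the diagonal mass matrix `M`. -/
noncomputable def massInvSqrt (S : OscillatorNetwork V) : Matrix V V ℝ :=
  Matrix.diagonal fun u => (Real.sqrt (S.mass u))⁻¹

/-- `H = M^{-1/2} K M^{-1/2}`. -/
noncomputable def hamiltonian (S : OscillatorNetwork V) : Matrix V V ℝ :=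
  S.massInvSqrt * S.stiffness * S.massInvSqrt

/-- `nbhd u` is the closed neighbourhood of `u`, enlarged by dummy vertices to exactly `s`
elements. In particular, every closed neighbourhood has at most `s` elements and every row of `H`
has at most `s` non-zero entries. -/
def IsPaddedNeighborhood (S : OscillatorNetwork V) (s : ℕ) (nbhd : V → Finset V) : Prop :=
  ∀ u, u ∈ nbhd u ∧ (∀ v, S.graph.Adj u v → v ∈ nbhd u) ∧ (nbhd u).card = s

end OscillatorNetwork

/-- The maximum norm, the largest absolute value of an entry. -/
noncomputable def maxNorm {V : Type} (H : Matrix V V ℝ) : ℝ :=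
  ⨆ p : V × V, |H p.1 p.2|

/-! ### Spectral data at an oscillator

`W` is an orthogonal matrix with `Wᵀ * H * W = diagonal lam`. -/

section Spectral

variable {V : Type} [Fintype V]

open Classical in
/-- The set of the eigenvalues `lam j` with `W u j ^ 2 > 0`. -/
noncomputable def supportedEigenvalues (W : Matrix V V ℝ) (lam : V → ℝ) (u : V) : Finset ℝ :=
  (Finset.univ.filter fun j => 0 < W u j ^ 2).image lam

open Classical in
/-- The weight of the eigenvalue `x` at `u`; the weights `W u j ^ 2` of a degenerate eigenvalue
are gathered. -/
noncomputable def weight (W : Matrix V V ℝ) (lam : V → ℝ) (u : V) (x : ℝ) : ℝ :=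
  ∑ j with lam j = x, W u j ^ 2

/-- The positive distances between eigenvalues with support at `u`. -/
def gaps (W : Matrix V V ℝ) (lam : V → ℝ) (u : V) : Set ℝ :=
  {d | ∃ i j, d = |lam i - lam j| ∧ 0 < |lam i - lam j| ∧ 0 < W u i ^ 2 ∧ 0 < W u j ^ 2}

/-- A list of pairs (estimated eigenvalue, estimated weight) is accurate if its entries belong to
distinct eigenvalues with support at `u`, each eigenvalue is estimated up to `ε` and each weight up
to `δ`, where an eigenvalue that is not in the list has the estimated weight `0`. -/
def IsAccurate (W : Matrix V V ℝ) (lam : V → ℝ) (u : V) (ε δ : ℝ) (L : List (ℝ × ℝ)) : Prop :=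
  ∃ σ : Fin L.length → ℝ, Function.Injective σ ∧
    (∀ k, σ k ∈ supportedEigenvalues W lam u ∧
      |(L.get k).1 - σ k| ≤ ε ∧ |(L.get k).2 - weight W lam u (σ k)| ≤ δ) ∧
    ∀ x ∈ supportedEigenvalues W lam u, x ∉ Set.range σ → |0 - weight W lam u x| ≤ δ

end Spectral

/-! ### Quantum registers and matrix oracles -/

/-- Bit strings of length `k`: the computational basis of `k` qubits. -/
abbrev Bits (k : ℕ) : Type := Fin k → Bool

/-- The all-zero bit string. -/
def zeros (k : ℕ) : Bits k := fun _ => false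

/-- A computational basis state. -/
def ket {B : Type} [DecidableEq B] (b : B) : B → ℂ := Pi.single b 1

/-- The computational basis of the registers that the position oracle acts on. -/
abbrev PosBasis (n : ℕ) : Type := Bits n × Bits n

/-- The computational basis of the registers that the angle oracle acts on: two vertices, and
`r` qubits for the angle with one qubit for the sign. -/
abbrev AngleBasis (n r : ℕ) : Type := PosBasis n × (Bits r × Bool)

/-- The computational basis of the whole quantum computer, with `w` further qubits. -/
abbrev Basis (n r w : ℕ) : Type := AngleBasis n r × Bits w

/-- `O_P |u⟩|0⟩ = s^{-1/2} ∑_{v ∈ nbhd u} |u⟩|v⟩`. -/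
def IsPositionOracle {n : ℕ} (s : ℕ) (nbhd : Bits n → Finset (Bits n))
    (OP : Matrix.unitaryGroup (PosBasis n) ℂ) : Prop :=
  ∀ u, (OP : Matrix (PosBasis n) (PosBasis n) ℂ) *ᵥ ket (u, zeros n) =
    ((Real.sqrt s : ℂ))⁻¹ • ∑ v ∈ nbhd u, ket (u, v)

/-- `O_ϑ |u,v⟩|0⟩ = |u,v⟩|ϑ_{uv}, Θ(-H_{uv})⟩` with `ϑ_{uv} = arccos √(|H_{uv}| / ‖H‖_max)`. The
number format of the angle register is `dec`, the angle that a string of `r` bits stands for, for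
instance `dec b = (π / 2) ∑ l, b l * 2 ^ (-(l + 1))`; the angles are represented exactly. -/
def IsAngleOracle {n r : ℕ} (dec : Bits r → ℝ) (H : Matrix (Bits n) (Bits n) ℝ)
    (OA : Matrix.unitaryGroup (AngleBasis n r) ℂ) : Prop :=
  ∃ θ : Bits n → Bits n → Bits r,
    (∀ u v, dec (θ u v) = Real.arccos (Real.sqrt (|H u v| / maxNorm H))) ∧
    ∀ u v, (OA : Matrix (AngleBasis n r) (AngleBasis n r) ℂ) *ᵥ ket ((u, v), (zeros r, false)) =
      ket ((u, v), (θ u v, decide (H u v < 0)))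

/-! ### Quantum query algorithms -/

/-- The four kinds of oracle queries. -/
inductive Query : Type
  | pos
  | posInv
  | angle
  | angleInv

/-- The action of a query on the whole quantum computer. -/
def Query.gate {n r : ℕ} (w : ℕ) (OP : Matrix.unitaryGroup (PosBasis n) ℂ)
    (OA : Matrix.unitaryGroup (AngleBasis n r) ℂ) :
    Query → Matrix (Basis n r w) (Basis n r w) ℂ
  | .pos => ((OP : Matrix (PosBasis n) (PosBasis n) ℂ) ⊗ₖ
      (1 : Matrix (Bits r × Bool) (Bits r × Bool) ℂ)) ⊗ₖ (1 : Matrix (Bits w) (Bits w) ℂ)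
  | .posInv => ((OP : Matrix (PosBasis n) (PosBasis n) ℂ)ᴴ ⊗ₖ
      (1 : Matrix (Bits r × Bool) (Bits r × Bool) ℂ)) ⊗ₖ (1 : Matrix (Bits w) (Bits w) ℂ)
  | .angle => (OA : Matrix (AngleBasis n r) (AngleBasis n r) ℂ) ⊗ₖ
      (1 : Matrix (Bits w) (Bits w) ℂ)
  | .angleInv => (OA : Matrix (AngleBasis n r) (AngleBasis n r) ℂ)ᴴ ⊗ₖ
      (1 : Matrix (Bits w) (Bits w) ℂ)

/-- A quantum query algorithm. A circuit on `2 * n + (r + 1) + work` qubits alternates fixed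
unitaries (`prep` at the start, and one after each query) with queries; it is started in the
all-zero state and measured in the computational basis. It is run `runs` times independently on
the same qubits, and `post` computes the output from the measured bit strings. -/
structure QueryAlgorithm (n r : ℕ) where
  work : ℕ
  prep : Matrix.unitaryGroup (Basis n r work) ℂ
  steps : List (Query × Matrix.unitaryGroup (Basis n r work) ℂ)
  runs : ℕ
  post : (Fin runs → Basis n r work) → List (ℝ × ℝ)

namespace QueryAlgorithm

variable {n r : ℕ}

/-- The number of qubits, those of the angle and sign registers included. -/
def qubits (A : QueryAlgorithm n r) : ℕ := 2 * n + (r + 1) + A.work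

/-- The total number of oracle queries, over all runs. -/
def queries (A : QueryAlgorithm n r) : ℕ := A.runs * A.steps.length

/-- The state of the quantum computer before the measurement in each run. -/
noncomputable def finalState (A : QueryAlgorithm n r) (OP : Matrix.unitaryGroup (PosBasis n) ℂ)
    (OA : Matrix.unitaryGroup (AngleBasis n r) ℂ) : Basis n r A.work → ℂ :=
  A.steps.foldl
    (fun ψ p => (p.2 : Matrix (Basis n r A.work) (Basis n r A.work) ℂ) *ᵥ
      (p.1.gate A.work OP OA *ᵥ ψ))
    ((A.prep : Matrix (Basis n r A.work) (Basis n r A.work) ℂ) *ᵥ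
      ket (((zeros n, zeros n), (zeros r, false)), zeros A.work))

open Classical in
/-- The probability that the output of the algorithm has the property `good`. -/
noncomputable def prob (A : QueryAlgorithm n r) (OP : Matrix.unitaryGroup (PosBasis n) ℂ)
    (OA : Matrix.unitaryGroup (AngleBasis n r) ℂ) (good : List (ℝ × ℝ) → Prop) : ℝ :=
  ∑ y : Fin A.runs → Basis n r A.work with good (A.post y),
    ∏ i, ‖A.finalState OP OA (y i)‖ ^ 2

end QueryAlgorithm

end ResponseQPE

/-! Put L = s‖H‖_max. A position query, an angle query and its inverse, with a rotation of a flag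
qubit in between, prepare from |u⟩|0⟩ a superposition over row u in which the sign of the flag has
mean H_uv/‖H‖_max. Exchanging the vertex registers between this preparation and its inverse gives a
Hermitian involution U whose compression to the states |v⟩|0⟩ is H/L
(`embed_compress_blockEncoding`). If Q is U followed by the reflection about these states, then (Q +
Q†)ψ = 2xψ for every embedded eigenvector ψ of H, with x = λ/L (`isWalkVector_reflection_mul`).

A clock with M = 2^m times and sine amplitudes a_t controls Q^t. It is measured not in the Fourier
basis but in an eigenbasis of J, half the adjacency matrix of a path. The outcome then estimates x,
the cosine of the phase, and the phases ±arccos x need not be told apart. The recursion 2x Q^(t+1)ψ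
= Q^(t+2)ψ + Q^tψ reduces J − x on the clock state to increments of a, so the mean square error is
at most 2π²/M² (`IsWalkVector.second_moment`). After the measurement the components of different
eigenvalues are still orthogonal, being eigenvectors of the Hermitian matrix Q + Q† for different
eigenvalues. Hence the outcomes follow a mixture of peaks around the points of Λ_u, with weights
exactly w_u(λ) (`normSq_measured_origin`).

The rest is classical. By Chebyshev's inequality the peaks are narrow once M is of order L max(1/ε,
1/(δΔ)). With order ln(N_u/ζ)/δ² runs, a Chernoff bound and a union bound over 2N_u + 1 events bring
all relevant frequencies close to their probabilities (`consistent_of_freq_close`). The output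
consists of the heavy atoms of any measure that is consistent with the samples. This suffices
because two measures consistent with the same samples have matching heavy atoms
(`Consistent.exists_match`). -/

namespace ResponseQPE

/-! ### Independent samples -/

section Samples

variable {B : Type*} [Fintype B] {R : ℕ}

/-- The fraction of the samples `y` that lie in `E`. -/
noncomputable def freq {B : Type*} {R : ℕ} (y : Fin R → B) (E : Set B) : ℝ :=
  (∑ i, E.indicator (fun _ => (1 : ℝ)) (y i)) / R

/-- The mass of `E` under the weights `p`. -/
noncomputable def mass (p : B → ℝ) (E : Set B) : ℝ :=
  ∑ b, p b * E.indicator (fun _ => (1 : ℝ)) b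

theorem indicator_one_mem {B : Type*} (E : Set B) (b : B) :
    0 ≤ E.indicator (fun _ => (1 : ℝ)) b ∧ E.indicator (fun _ => (1 : ℝ)) b ≤ 1 := by
  by_cases h : b ∈ E <;> simp [h]

theorem sum_prod_eq_pow (f : B → ℝ) :
    ∑ y : Fin R → B, ∏ i, f (y i) = (∑ b, f b) ^ R := by
  have := Finset.prod_univ_sum (fun _ : Fin R => (Finset.univ : Finset B)) (fun _ b => f b)
  simpa using this.symm

theorem mass_nonneg {p : B → ℝ} (hp : ∀ b, 0 ≤ p b) (E : Set B) : 0 ≤ mass p E :=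
  Finset.sum_nonneg fun b _ => mul_nonneg (hp b) (indicator_one_mem E b).1

theorem mass_le_one {p : B → ℝ} (hp : ∀ b, 0 ≤ p b) (hsum : ∑ b, p b = 1) (E : Set B) :
    mass p E ≤ 1 := by
  rw [← hsum]
  exact Finset.sum_le_sum fun b _ => mul_le_of_le_one_right (hp b) (indicator_one_mem E b).2

open Classical in
/-- A Chernoff bound for the sum of independent samples of a bounded centred variable. -/
theorem chernoff_bound {p : B → ℝ} (hp : ∀ b, 0 ≤ p b) (hsum : ∑ b, p b = 1) {X : B → ℝ}
    (hX : ∀ b, |X b| ≤ 1) (hmean : ∑ b, p b * X b = 0) {τ : ℝ} (h0 : 0 ≤ τ) (h1 : τ ≤ 1) :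
    ∑ y : Fin R → B with R * τ ≤ ∑ i, X (y i), ∏ i, p (y i) ≤ Real.exp (-(R * τ ^ 2 / 4)) := by
  -- This s minimizes the exponent R(s² − sτ); τ ≤ 1 keeps |s X| ≤ 1, the range in which e^y ≤ 1 + y
  -- + y² is used.
  set s : ℝ := τ / 2
  have hmgf : ∑ b, p b * Real.exp (s * X b) ≤ Real.exp (s ^ 2) := by
    calc ∑ b, p b * Real.exp (s * X b)
        ≤ ∑ b, (p b + s * (p b * X b) + p b * s ^ 2) := by
          refine Finset.sum_le_sum fun b _ => ?_
          have hs : |s * X b| ≤ 1 := by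
            rw [abs_mul, abs_of_nonneg (by positivity)]
            exact mul_le_one₀ (by simp only [s]; linarith) (abs_nonneg _) (hX b)
          have h2 := (abs_le.mp (Real.abs_exp_sub_one_sub_id_le hs)).2
          have h3 : (s * X b) ^ 2 ≤ s ^ 2 := by
            have : X b ^ 2 ≤ 1 := by rw [← sq_abs]; exact pow_le_one₀ (abs_nonneg _) (hX b)
            rw [mul_pow]; exact mul_le_of_le_one_right (sq_nonneg _) this
          calc p b * Real.exp (s * X b) ≤ p b * (1 + s * X b + s ^ 2) :=
                mul_le_mul_of_nonneg_left (by linarith) (hp b)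
            _ = _ := by ring
      _ = 1 + s ^ 2 := by
          rw [Finset.sum_add_distrib, Finset.sum_add_distrib, ← Finset.mul_sum, hmean,
            ← Finset.sum_mul, hsum]; ring
      _ ≤ Real.exp (s ^ 2) := by linarith [Real.add_one_le_exp (s ^ 2)]
  calc ∑ y : Fin R → B with R * τ ≤ ∑ i, X (y i), ∏ i, p (y i)
      ≤ ∑ y : Fin R → B with R * τ ≤ ∑ i, X (y i),
          Real.exp (-(s * (R * τ))) * ∏ i, (p (y i) * Real.exp (s * X (y i))) := by
        refine Finset.sum_le_sum fun y hy => ?_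
        rw [Finset.prod_mul_distrib, ← Real.exp_sum, ← Finset.mul_sum, mul_left_comm,
          ← Real.exp_add]
        -- Markov's inequality: on the event, the exponential factor is at least 1.
        refine le_mul_of_one_le_right (Finset.prod_nonneg fun i _ => hp _) ?_
        rw [Real.one_le_exp_iff]
        have := mul_le_mul_of_nonneg_left (Finset.mem_filter.mp hy).2 (by positivity : 0 ≤ s)
        linarith
    _ ≤ ∑ y : Fin R → B,
          Real.exp (-(s * (R * τ))) * ∏ i, (p (y i) * Real.exp (s * X (y i))) :=
        Finset.sum_le_sum_of_subset_of_nonneg (Finset.filter_subset _ _) fun y _ _ =>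
          mul_nonneg (Real.exp_nonneg _) (Finset.prod_nonneg fun i _ =>
            mul_nonneg (hp _) (Real.exp_nonneg _))
    _ = Real.exp (-(s * (R * τ))) * (∑ b, p b * Real.exp (s * X b)) ^ R := by
        rw [← Finset.mul_sum, sum_prod_eq_pow (fun b => p b * Real.exp (s * X b))]
    _ ≤ Real.exp (-(s * (R * τ))) * Real.exp (s ^ 2) ^ R := by
        gcongr
        exact Finset.sum_nonneg fun b _ => mul_nonneg (hp b) (Real.exp_nonneg _)
    _ = Real.exp (-(R * τ ^ 2 / 4)) := by
        rw [← Real.exp_nat_mul, ← Real.exp_add]; congr 1; simp only [s]; ring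

-- `chernoff_bound` applies to the centred indicator of `E` and to its negative; the factor 2 counts
-- the two sides.
open Classical in
theorem freq_deviation_le {p : B → ℝ} (hp : ∀ b, 0 ≤ p b) (hsum : ∑ b, p b = 1) (hR : 0 < R)
    (E : Set B) {τ : ℝ} (h0 : 0 ≤ τ) (h1 : τ ≤ 1) :
    ∑ y : Fin R → B with ¬|freq y E - mass p E| ≤ τ, ∏ i, p (y i) ≤
      2 * Real.exp (-(R * τ ^ 2 / 4)) := by
  set I : B → ℝ := E.indicator (fun _ => (1 : ℝ)) with hI
  have hq0 := mass_nonneg hp E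
  have hq1 := mass_le_one hp hsum E
  have hI01 := indicator_one_mem E
  have hR' : (0 : ℝ) < R := by exact_mod_cast hR
  have hmean : ∑ b, p b * (I b - mass p E) = 0 := by
    simp only [mul_sub, Finset.sum_sub_distrib, ← Finset.sum_mul, hsum]
    simp [mass, I]
  have hup := chernoff_bound (R := R) hp hsum (X := fun b => I b - mass p E)
    (fun b => abs_le.mpr ⟨by linarith [(hI01 b).1], by linarith [(hI01 b).2]⟩) hmean h0 h1
  have hdown := chernoff_bound (R := R) hp hsum (X := fun b => mass p E - I b)
    (fun b => abs_le.mpr ⟨by linarith [(hI01 b).2], by linarith [(hI01 b).1]⟩)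
    (by rw [← neg_eq_zero, ← Finset.sum_neg_distrib, ← hmean]
        exact Finset.sum_congr rfl fun b _ => by ring) h0 h1
  rw [two_mul]
  refine le_trans ?_ (add_le_add hup hdown)
  have hf : ∀ y : Fin R → B, 0 ≤ ∏ i, p (y i) := fun y => Finset.prod_nonneg fun i _ => hp _
  rw [← Finset.sum_union_inter]
  refine le_trans (Finset.sum_le_sum_of_subset_of_nonneg ?_ fun y _ _ => hf y)
    (le_add_of_nonneg_right (Finset.sum_nonneg fun y _ => hf y))
  · intro y hy
    have hfr : ∑ i, I (y i) = R * freq y E := by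
      rw [freq, mul_div_cancel₀ _ hR'.ne']
    have hy := (Finset.mem_filter.mp hy).2
    simp only [Finset.mem_union, Finset.mem_filter, Finset.mem_univ, true_and,
      Finset.sum_sub_distrib, hfr, Finset.sum_const, Finset.card_univ, Fintype.card_fin,
      nsmul_eq_mul, ← mul_sub]
    rw [not_le, lt_abs] at hy
    rcases hy with hy | hy
    · exact Or.inl (mul_le_mul_of_nonneg_left hy.le hR'.le)
    · exact Or.inr (mul_le_mul_of_nonneg_left (by linarith) hR'.le)

open Classical in
/-- With high probability the frequencies of finitely many events are all close to their
probabilities. -/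
theorem one_sub_le_sum_freq_close {p : B → ℝ} (hp : ∀ b, 0 ≤ p b) (hsum : ∑ b, p b = 1)
    (hR : 0 < R) (I : Finset (Set B)) {τ : ℝ} (h0 : 0 ≤ τ) (h1 : τ ≤ 1) :
    1 - I.card * (2 * Real.exp (-(R * τ ^ 2 / 4))) ≤
      ∑ y : Fin R → B with ∀ E ∈ I, |freq y E - mass p E| ≤ τ, ∏ i, p (y i) := by
  have hf : ∀ y : Fin R → B, 0 ≤ ∏ i, p (y i) := fun y => Finset.prod_nonneg fun i _ => hp _
  have htot : ∑ y : Fin R → B, ∏ i, p (y i) = 1 := by rw [sum_prod_eq_pow, hsum, one_pow]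
  rw [← Finset.sum_filter_add_sum_filter_not _
    (fun y : Fin R → B => ∀ E ∈ I, |freq y E - mass p E| ≤ τ)] at htot
  have hbad : ∑ y : Fin R → B with ¬∀ E ∈ I, |freq y E - mass p E| ≤ τ, ∏ i, p (y i) ≤
      ∑ E ∈ I, ∑ y : Fin R → B with ¬|freq y E - mass p E| ≤ τ, ∏ i, p (y i) := by
    simp only [Finset.sum_filter]
    rw [Finset.sum_comm]
    refine Finset.sum_le_sum fun y _ => ?_
    have hnn : ∀ E ∈ I, 0 ≤ if ¬|freq y E - mass p E| ≤ τ then ∏ i, p (y i) else 0 :=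
      fun E _ => by split_ifs <;> simp [hf y]
    by_cases h : ∀ E ∈ I, |freq y E - mass p E| ≤ τ
    · rw [if_neg (not_not.mpr h)]
      exact Finset.sum_nonneg hnn
    · rw [if_pos h]
      push Not at h
      obtain ⟨E, hE, hEy⟩ := h
      refine le_trans ?_ (Finset.single_le_sum hnn hE)
      rw [if_pos (not_le.mpr hEy)]
  have hcard := Finset.sum_le_card_nsmul I _ _ fun E _ =>
    freq_deviation_le (R := R) hp hsum hR E h0 h1
  rw [nsmul_eq_mul] at hcard
  linarith

end Samples

/-! ### Reading off a spectral measure from noisy samples -/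

section Consistency

variable {R : ℕ}

/-- The samples `z` are consistent with a measure with the atoms `Λ` of weights `w`. -/
structure Consistent (Δ ε δ : ℝ) (z : Fin R → ℝ) (Λ : Finset ℝ) (w : ℝ → ℝ) : Prop where
  gap : ∀ x ∈ Λ, ∀ x' ∈ Λ, |x - x'| < Δ → x = x'
  near : ∀ x ∈ Λ, |freq z {v | |v - x| < Δ / 4} - w x| ≤ δ / 32
  stray : freq z {v | ∀ x ∈ Λ, Δ / 4 ≤ |v - x|} ≤ δ / 32
  peak : ∀ x ∈ Λ, 3 / 4 * w x - δ / 32 ≤ freq z {v | |v - x| ≤ min (ε / 2) (Δ / 16)}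

theorem freq_le_add {B : Type*} {y : Fin R → B} {E E₁ E₂ : Set B}
    (h : ∀ i, y i ∈ E → y i ∈ E₁ ∨ y i ∈ E₂) : freq y E ≤ freq y E₁ + freq y E₂ := by
  rw [freq, freq, freq, ← add_div, ← Finset.sum_add_distrib]
  gcongr with i
  have h1 := indicator_one_mem E₁ (y i)
  have h2 := indicator_one_mem E₂ (y i)
  by_cases hE : y i ∈ E
  · rcases h i hE with h' | h'
    · simp only [Set.indicator_of_mem hE, Set.indicator_of_mem h']; linarith
    · simp only [Set.indicator_of_mem hE, Set.indicator_of_mem h']; linarith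
  · simp only [Set.indicator_of_notMem hE]; linarith

/-- Serves for two peaks without a common sample: if both fit into one window, up to stray samples,
their frequencies add up. -/
theorem freq_add_freq_le {B : Type*} {y : Fin R → B} {E₁ E₂ F₁ F₂ : Set B}
    (h₁ : ∀ i, y i ∈ E₁ → y i ∈ F₁) (h₂ : ∀ i, y i ∈ E₂ → y i ∈ F₁ ∨ y i ∈ F₂)
    (hd : ∀ i, y i ∈ E₁ → y i ∉ E₂) : freq y E₁ + freq y E₂ ≤ freq y F₁ + freq y F₂ := by
  rw [freq, freq, freq, freq, ← add_div, ← add_div, ← Finset.sum_add_distrib,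
    ← Finset.sum_add_distrib]
  gcongr ?_ / _
  refine Finset.sum_le_sum fun i _ => ?_
  have f1 := indicator_one_mem F₁ (y i)
  have f2 := indicator_one_mem F₂ (y i)
  by_cases hE₁ : y i ∈ E₁
  · simp only [Set.indicator_of_mem hE₁, Set.indicator_of_notMem (hd i hE₁),
      Set.indicator_of_mem (h₁ i hE₁)]
    linarith
  · by_cases hE₂ : y i ∈ E₂
    · rcases h₂ i hE₂ with h' | h' <;>
        simp only [Set.indicator_of_notMem hE₁, Set.indicator_of_mem hE₂,
          Set.indicator_of_mem h'] <;> linarith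
    · simp only [Set.indicator_of_notMem hE₁, Set.indicator_of_notMem hE₂]; linarith

/-- If two measures are consistent with the same samples, a heavy atom of one has a counterpart
in the other. -/
theorem Consistent.exists_match {Δ ε δ : ℝ} (hδ : 0 < δ) {z : Fin R → ℝ}
    {Λ Λ' : Finset ℝ} {w w' : ℝ → ℝ} (h : Consistent Δ ε δ z Λ w)
    (h' : Consistent Δ ε δ z Λ' w') {x' : ℝ} (hx' : x' ∈ Λ') (hw' : δ / 2 ≤ w' x') :
    ∃ x ∈ Λ, |x' - x| ≤ ε ∧ |x' - x| < 5 * Δ / 16 ∧ |w' x' - w x| ≤ δ / 4 := by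
  -- The peak of `x'` has frequency at least 3δ/8 − δ/32, which exceeds the stray frequency δ/32; so
  -- one of its samples is close to an atom of `Λ`.
  obtain ⟨i, hi, x, hx, hix⟩ : ∃ i, |z i - x'| ≤ min (ε / 2) (Δ / 16) ∧
      ∃ x ∈ Λ, |z i - x| < Δ / 4 := by
    by_contra! hcon
    have h1 := freq_le_add (y := z) (E := {v | |v - x'| ≤ min (ε / 2) (Δ / 16)})
      (E₁ := {v | ∀ x ∈ Λ, Δ / 4 ≤ |v - x|}) (E₂ := ∅) fun i hi => Or.inl (hcon i hi)
    have h2 : freq z (∅ : Set ℝ) = 0 := by simp [freq]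
    linarith [h.stray, h'.peak x' hx']
  have hi2 := hi.trans (min_le_right _ _)
  have hxx : |x' - x| < 5 * Δ / 16 := by
    rw [abs_le] at hi2; rw [abs_lt] at hix ⊢; constructor <;> linarith
  have hΔ : 0 < Δ := by linarith [abs_nonneg (x' - x)]
  -- Another atom of `Λ'` near `v` would be within Δ/4 + Δ/4 + 5Δ/16 < Δ of `x'`. So the windows
  -- around `x` and `x'` hold the same samples up to strays, and the two weights differ by at most
  -- 3δ/32.
  have hA : ∀ v, |v - x| < Δ / 4 → |v - x'| < Δ / 4 ∨ ∀ b ∈ Λ', Δ / 4 ≤ |v - b| := by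
    intro v hv
    by_contra! hcon
    obtain ⟨h1, b, hb, hvb⟩ := hcon
    have : b = x' := h'.gap b hb x' hx' (by
      rw [abs_lt] at *; constructor <;> linarith)
    subst this; linarith
  have hA' : ∀ v, |v - x'| < Δ / 4 → |v - x| < Δ / 4 ∨ ∀ b ∈ Λ, Δ / 4 ≤ |v - b| := by
    intro v hv
    by_contra! hcon
    obtain ⟨h1, b, hb, hvb⟩ := hcon
    have : b = x := h.gap b hb x hx (by
      rw [abs_lt] at *; constructor <;> linarith)
    subst this; linarith
  have f1 := freq_le_add (y := z) (E := {v | |v - x| < Δ / 4})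
    (E₁ := {v | |v - x'| < Δ / 4}) (E₂ := {v | ∀ x ∈ Λ', Δ / 4 ≤ |v - x|}) fun i hi => hA _ hi
  have f2 := freq_le_add (y := z) (E := {v | |v - x'| < Δ / 4})
    (E₁ := {v | |v - x| < Δ / 4}) (E₂ := {v | ∀ x ∈ Λ, Δ / 4 ≤ |v - x|}) fun i hi => hA' _ hi
  have n1 := abs_le.mp (h.near x hx)
  have n2 := abs_le.mp (h'.near x' hx')
  have s1 := h.stray
  have s2 := h'.stray
  have p1 := h.peak x hx
  have p2 := h'.peak x' hx'
  refine ⟨x, hx, ?_, hxx, abs_le.mpr ⟨by linarith, by linarith⟩⟩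
  -- Each peak carries about three quarters, hence more than half, of nearly the same weight;
  -- disjoint peaks would overfill one window. A common sample is within ε/2 of both atoms.
  obtain ⟨k, hk, hk'⟩ : ∃ k, |z k - x| ≤ min (ε / 2) (Δ / 16) ∧
      |z k - x'| ≤ min (ε / 2) (Δ / 16) := by
    by_contra! hcon
    have hρ : min (ε / 2) (Δ / 16) < Δ / 4 := (min_le_right _ _).trans_lt (by linarith)
    have h1 := freq_add_freq_le (y := z) (E₁ := {v | |v - x| ≤ min (ε / 2) (Δ / 16)})
      (E₂ := {v | |v - x'| ≤ min (ε / 2) (Δ / 16)}) (F₁ := {v | |v - x| < Δ / 4})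
      (F₂ := {v | ∀ x ∈ Λ, Δ / 4 ≤ |v - x|})
      (fun i hi => lt_of_le_of_lt hi hρ) (fun i hi => hA' _ (lt_of_le_of_lt hi hρ))
      (fun i hi => not_le.mpr (hcon i hi))
    linarith
  have g1 := abs_le.mp (hk.trans (min_le_left _ _))
  have g2 := abs_le.mp (hk'.trans (min_le_left _ _))
  exact abs_le.mpr ⟨by linarith, by linarith⟩

open Classical in
/-- The heavy atoms of some measure that is consistent with the samples. -/
noncomputable def estimate (Δ ε δ : ℝ) (z : Fin R → ℝ) : List (ℝ × ℝ) :=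
  if h : ∃ Λw : Finset ℝ × (ℝ → ℝ), Consistent Δ ε δ z Λw.1 Λw.2 then
    (h.choose.1.filter fun x => δ / 2 ≤ h.choose.2 x).toList.map fun x => (x, h.choose.2 x)
  else []

-- The matching is used in both directions: from the chosen measure to the true one for the errors,
-- and back for completeness. A true weight above δ has a counterpart of weight at least 3δ/4, which
-- is listed; and atoms with a common partner are less than 5Δ/8 apart, hence equal.
open Classical in
theorem isAccurate_estimate {V : Type} [Fintype V] {W : Matrix V V ℝ} {lam : V → ℝ} {u : V}
    {Δ ε δ : ℝ} (hδ : 0 < δ) {z : Fin R → ℝ}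
    (hc : Consistent Δ ε δ z (supportedEigenvalues W lam u) (weight W lam u)) :
    IsAccurate W lam u ε δ (estimate Δ ε δ z) := by
  have hex : ∃ Λw : Finset ℝ × (ℝ → ℝ), Consistent Δ ε δ z Λw.1 Λw.2 := ⟨⟨_, _⟩, hc⟩
  rw [estimate, dif_pos hex]
  have hc' := hex.choose_spec
  set Λ' := hex.choose.1
  set w' := hex.choose.2
  set F := Λ'.filter fun x => δ / 2 ≤ w' x with hF
  have hm : ∀ x ∈ F, ∃ a ∈ supportedEigenvalues W lam u,
      |x - a| ≤ ε ∧ |x - a| < 5 * Δ / 16 ∧ |w' x - weight W lam u a| ≤ δ / 4 := fun x hx =>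
    hc.exists_match hδ hc' (Finset.mem_filter.mp hx).1 (Finset.mem_filter.mp hx).2
  choose! m hmΛ hmε hmΔ hmw using hm
  set L := F.toList.map fun x => (x, w' x) with hL
  have hget : ∀ k : Fin L.length, (L.get k).1 ∈ F ∧ (L.get k).2 = w' (L.get k).1 := by
    intro k
    obtain ⟨x, hx, hxk⟩ := List.mem_map.mp (List.get_mem L k)
    rw [← hxk]
    exact ⟨Finset.mem_toList.mp hx, rfl⟩
  have hnodup : L.Nodup := F.nodup_toList.map fun a b hab => (Prod.mk.inj hab).1
  refine ⟨fun k => m (L.get k).1, fun k l hkl => ?_, fun k => ?_, fun x hx hxr => ?_⟩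
  · have h1 := abs_lt.mp (hmΔ _ (hget k).1)
    have h2 := abs_lt.mp (hmΔ _ (hget l).1)
    simp only at hkl
    rw [hkl] at h1
    have h3 : (L.get k).1 = (L.get l).1 :=
      hc'.gap _ (Finset.mem_filter.mp (hget k).1).1 _ (Finset.mem_filter.mp (hget l).1).1
        (abs_lt.mpr ⟨by linarith, by linarith⟩)
    refine List.nodup_iff_injective_get.mp hnodup (Prod.ext h3 ?_)
    rw [(hget k).2, (hget l).2, h3]
  · refine ⟨hmΛ _ (hget k).1, hmε _ (hget k).1, ?_⟩
    rw [(hget k).2]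
    linarith [hmw _ (hget k).1]
  · have hw0 : 0 ≤ weight W lam u x := Finset.sum_nonneg fun j _ => sq_nonneg _
    rw [zero_sub, abs_neg, abs_of_nonneg hw0]
    by_contra! hlt
    obtain ⟨x', hx', -, hx'Δ, hx'w⟩ := hc'.exists_match hδ hc hx (by linarith)
    have hx'F : x' ∈ F := Finset.mem_filter.mpr ⟨hx', by linarith [(abs_le.mp hx'w).2]⟩
    obtain ⟨k, hk⟩ := List.get_of_mem (l := L) (a := (x', w' x'))
      (List.mem_map.mpr ⟨x', Finset.mem_toList.mpr hx'F, rfl⟩)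
    refine hxr ⟨k, ?_⟩
    simp only [hk]
    have h1 := abs_lt.mp hx'Δ
    have h2 := abs_lt.mp (hmΔ _ hx'F)
    exact hc.gap _ (hmΛ _ hx'F) _ hx (abs_lt.mpr ⟨by linarith, by linarith⟩)

end Consistency

/-! ### Squared norms -/

section NormSq

variable {Y : Type*} [Fintype Y]

/-- The squared Euclidean norm. -/
noncomputable def normSq (v : Y → ℂ) : ℝ := ∑ i, ‖v i‖ ^ 2

theorem ofReal_normSq (v : Y → ℂ) : (normSq v : ℂ) = star v ⬝ᵥ v := by
  simp only [normSq, dotProduct, Complex.ofReal_sum, Pi.star_apply, Complex.star_def,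
    Complex.conj_mul']
  simp

theorem normSq_nonneg (v : Y → ℂ) : 0 ≤ normSq v :=
  Finset.sum_nonneg fun _ _ => sq_nonneg _

theorem normSq_smul (c : ℂ) (v : Y → ℂ) : normSq (c • v) = ‖c‖ ^ 2 * normSq v := by
  simp [normSq, Finset.mul_sum, mul_pow]

theorem star_mulVec_dotProduct (A : Matrix Y Y ℂ) (v w : Y → ℂ) :
    star (A *ᵥ v) ⬝ᵥ w = star v ⬝ᵥ (Aᴴ *ᵥ w) := by
  rw [Matrix.star_mulVec, ← Matrix.dotProduct_mulVec]

/-- Pythagoras for finitely many pairwise orthogonal vectors. -/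
theorem normSq_sum_of_orthogonal {ι : Type*} (s : Finset ι) (f : ι → Y → ℂ)
    (h : ∀ i ∈ s, ∀ j ∈ s, i ≠ j → star (f i) ⬝ᵥ f j = 0) :
    normSq (∑ i ∈ s, f i) = ∑ i ∈ s, normSq (f i) := by
  have : (normSq (∑ i ∈ s, f i) : ℂ) = ∑ i ∈ s, (normSq (f i) : ℂ) := by
    rw [ofReal_normSq, star_sum, sum_dotProduct]
    refine Finset.sum_congr rfl fun i hi => ?_
    rw [dotProduct_sum, ofReal_normSq]
    exact Finset.sum_eq_single i (fun j hj hij => h i hi j hj hij.symm) (fun h => absurd hi h)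
  exact_mod_cast this

/-- Eigenvectors of a Hermitian matrix for different eigenvalues are orthogonal. -/
theorem dotProduct_eq_zero_of_eigenvalue_ne {D : Matrix Y Y ℂ} (hD : D.IsHermitian)
    {v w : Y → ℂ} {a b : ℝ} (hv : D *ᵥ v = (a : ℂ) • v) (hw : D *ᵥ w = (b : ℂ) • w)
    (hab : a ≠ b) : star v ⬝ᵥ w = 0 := by
  have h := star_mulVec_dotProduct D v w
  rw [hD.eq, hv, hw, star_smul, smul_dotProduct, dotProduct_smul, smul_eq_mul, smul_eq_mul,
    Complex.star_def, Complex.conj_ofReal] at h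
  have h' : ((a : ℂ) - b) * (star v ⬝ᵥ w) = 0 := by rw [sub_mul, h, sub_self]
  exact (mul_eq_zero.mp h').resolve_left (sub_ne_zero.mpr (by exact_mod_cast hab))

variable [DecidableEq Y]

theorem normSq_mulVec {U : Matrix Y Y ℂ} (hU : U ∈ Matrix.unitaryGroup Y ℂ) (v : Y → ℂ) :
    normSq (U *ᵥ v) = normSq v := by
  have h : Uᴴ * U = 1 := Matrix.mem_unitaryGroup_iff'.mp hU
  have : (normSq (U *ᵥ v) : ℂ) = normSq v := by
    rw [ofReal_normSq, ofReal_normSq, star_mulVec_dotProduct, Matrix.mulVec_mulVec, h,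
      Matrix.one_mulVec]
  exact_mod_cast this

/-- A unit vector is a column of some unitary matrix. -/
theorem exists_unitary_mulVec_ket {Y : Type} [Fintype Y] [DecidableEq Y] (b : Y)
    {v : Y → ℂ} (hv : normSq v = 1) :
    ∃ G : Matrix.unitaryGroup Y ℂ, (G : Matrix Y Y ℂ) *ᵥ ket b = v := by
  -- Only the value at `b` matters: the family is restricted to `{b}` and then extended to an
  -- orthonormal basis.
  let f : Y → EuclideanSpace ℂ Y := fun _ => WithLp.toLp 2 v
  have hf : Orthonormal ℂ (({b} : Set Y).domRestrict f) := by
    rw [orthonormal_iff_ite]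
    rintro ⟨i, hi⟩ ⟨j, hj⟩
    obtain rfl : i = b := hi
    obtain rfl : j = i := hj
    rw [if_pos rfl]
    change inner ℂ (WithLp.toLp 2 v) (WithLp.toLp 2 v) = (1 : ℂ)
    rw [inner_self_eq_norm_sq_to_K, ← Complex.ofReal_one, ← hv, normSq]
    norm_cast
    rw [EuclideanSpace.norm_sq_eq]
    rfl
  obtain ⟨e, he⟩ := hf.exists_orthonormalBasis_extension_of_card_eq (by simp)
  refine ⟨⟨(EuclideanSpace.basisFun Y ℂ).toBasis.toMatrix e,
    (EuclideanSpace.basisFun Y ℂ).toMatrix_orthonormalBasis_mem_unitary e⟩, ?_⟩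
  ext y
  simp [ket, Module.Basis.toMatrix_apply, he b rfl, f]

end NormSq

/-! ### The clock -/

section Clock

/-- One half of the adjacency matrix of a path with `M` vertices. -/
noncomputable def pathMatrix (M : ℕ) : Matrix (Fin M) (Fin M) ℂ :=
  Matrix.of fun i j => if (i : ℕ) + 1 = j ∨ (j : ℕ) + 1 = i then 1 / 2 else 0

theorem isHermitian_pathMatrix (M : ℕ) : (pathMatrix M).IsHermitian := by
  ext i j
  simp only [pathMatrix, Matrix.conjTranspose_apply, Matrix.of_apply]
  simp only [or_comm]
  split_ifs <;> simp

/-- In this form the equation says that `J`, acting on the clock before the measurement, multiplies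
the component of the outcome `t` by `ξ t`. -/
theorem exists_unitary_diagonalizing {T : Type*} [Fintype T] [DecidableEq T] {J : Matrix T T ℂ}
    (hJ : J.IsHermitian) : ∃ (V : Matrix.unitaryGroup T ℂ) (ξ : T → ℝ),
      (V : Matrix T T ℂ)ᴴ * J = Matrix.diagonal (fun t => (ξ t : ℂ)) * (V : Matrix T T ℂ)ᴴ := by
  refine ⟨hJ.eigenvectorUnitary, hJ.eigenvalues, ?_⟩
  have h : (hJ.eigenvectorUnitary : Matrix T T ℂ)ᴴ * (hJ.eigenvectorUnitary : Matrix T T ℂ) = 1 :=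
    Matrix.mem_unitaryGroup_iff'.mp hJ.eigenvectorUnitary.2
  have hs := hJ.spectral_theorem
  rw [Unitary.conjStarAlgAut_apply] at hs
  have hs' := congrArg ((hJ.eigenvectorUnitary : Matrix T T ℂ)ᴴ * ·) hs
  simp only [← mul_assoc, h, one_mul] at hs'
  exact hs'

variable {Y : Type*} {M : ℕ}

/-- The condition `h M = 0` supplies the missing neighbour at the far end of the path. At the near
end `i - 1` is truncated to 0, hence the `if`. -/
theorem sum_pathMatrix_smul {h : ℕ → Y → ℂ} (hM : h M = 0) (i : Fin M) :
    ∑ j, pathMatrix M i j • h j =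
      (1 / 2 : ℂ) • (h (i + 1) + if (i : ℕ) = 0 then 0 else h (i - 1)) := by
  have h1 : ∀ j : ℕ, (if (i : ℕ) + 1 = j ∨ j + 1 = i then (1 / 2 : ℂ) else 0) • h j =
      (if (i : ℕ) + 1 = j then (1 / 2 : ℂ) • h j else 0) +
        if j = (i : ℕ) - 1 then (if (i : ℕ) = 0 then 0 else (1 / 2 : ℂ) • h j) else 0 := by
    intro j
    by_cases hi : (i : ℕ) = 0
    · by_cases hj : 1 = j <;> simp [hi, hj]
    · by_cases hj : (i : ℕ) + 1 = j
      · have : ¬ j = (i : ℕ) - 1 := by omega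
        simp [hj, this]
      · by_cases hj' : j + 1 = i
        · have : j = (i : ℕ) - 1 := by omega
          rw [if_pos (Or.inr hj'), if_neg hj, if_pos this, if_neg hi, zero_add]
        · have : ¬ j = (i : ℕ) - 1 := by omega
          simp [hj, hj', this]
  simp only [pathMatrix, Matrix.of_apply]
  rw [Fin.sum_univ_eq_sum_range
    (fun j => (if (i : ℕ) + 1 = j ∨ j + 1 = i then (1 / 2 : ℂ) else 0) • h j) M]
  simp only [h1, Finset.sum_add_distrib]
  rw [Finset.sum_ite_eq, Finset.sum_ite_eq', smul_add]
  congr 1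
  · split_ifs with hlt
    · rfl
    · have : (i : ℕ) + 1 = M := by have := i.2; simp at hlt; omega
      rw [this, hM, smul_zero]
  · have : (i : ℕ) - 1 ∈ Finset.range M := by have := i.2; simp; omega
    rw [if_pos this]
    split_ifs <;> simp

variable [Fintype Y]

theorem sum_normSq_sum_smul {V : Matrix (Fin M) (Fin M) ℂ}
    (hV : V ∈ Matrix.unitaryGroup (Fin M) ℂ) (h : Fin M → Y → ℂ) :
    ∑ k, normSq (∑ t, star (V t k) • h t) = ∑ t, normSq (h t) := by
  simp only [normSq]
  rw [Finset.sum_comm, Finset.sum_comm (s := (Finset.univ : Finset (Fin M)))]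
  refine Finset.sum_congr rfl fun y _ => ?_
  have := normSq_mulVec (Unitary.star_mem hV) (fun t => h t y)
  simpa [normSq, Matrix.mulVec, dotProduct, Matrix.star_apply, Finset.sum_apply] using this

variable [DecidableEq Y]

/-- A walk operator acts on `ψ` with the phases `±arccos x`. -/
structure IsWalkVector (Q : Matrix Y Y ℂ) (ψ : Y → ℂ) (x : ℝ) : Prop where
  unitary : Q ∈ Matrix.unitaryGroup Y ℂ
  eigen : Q *ᵥ ψ + Qᴴ *ᵥ ψ = ((2 * x : ℝ) : ℂ) • ψ

/-- The component of the outcome `k` when the clock is measured in the basis `V`. -/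
noncomputable def measured (V : Matrix (Fin M) (Fin M) ℂ) (a : ℕ → ℝ) (Q : Matrix Y Y ℂ)
    (ψ : Y → ℂ) (k : Fin M) : Y → ℂ :=
  ∑ t : Fin M, star (V t k) • ((a t : ℂ) • (Q ^ (t : ℕ) *ᵥ ψ))

theorem sum_normSq_measured {Q : Matrix Y Y ℂ} (hQ : Q ∈ Matrix.unitaryGroup Y ℂ) (ψ : Y → ℂ)
    {V : Matrix (Fin M) (Fin M) ℂ}
    (hV : V ∈ Matrix.unitaryGroup (Fin M) ℂ) {a : ℕ → ℝ} (ha : ∑ t : Fin M, a t ^ 2 = 1) :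
    ∑ k, normSq (measured V a Q ψ k) = normSq ψ := by
  simp only [measured]
  rw [sum_normSq_sum_smul hV]
  simp only [normSq_smul, normSq_mulVec (pow_mem hQ _), Complex.norm_real, Real.norm_eq_abs, sq_abs,
    ← Finset.sum_mul, ha, one_mul]

namespace IsWalkVector

variable {Q : Matrix Y Y ℂ} {ψ : Y → ℂ} {x : ℝ}

/-- Apply `Q ^ (t + 1)` to the eigenvalue equation of `Q + Qᴴ`. This Chebyshev recursion replaces
any explicit use of the phases ±arccos x. -/
theorem pow_succ_succ (h : IsWalkVector Q ψ x) (t : ℕ) :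
    ((2 * x : ℝ) : ℂ) • (Q ^ (t + 1) *ᵥ ψ) = Q ^ (t + 2) *ᵥ ψ + Q ^ t *ᵥ ψ := by
  have hQ : Q * Qᴴ = 1 := Matrix.mem_unitaryGroup_iff.mp h.unitary
  rw [← Matrix.mulVec_smul, ← h.eigen, Matrix.mulVec_add, Matrix.mulVec_mulVec,
    Matrix.mulVec_mulVec, pow_succ Q t, mul_assoc, mul_assoc, hQ, mul_one, pow_add, sq]

/-- `Q + Qᴴ` commutes with the powers of `Q`. The consequence of interest is that components with
different `x` remain orthogonal for each outcome. -/
theorem eigen_measured (h : IsWalkVector Q ψ x) (V : Matrix (Fin M) (Fin M) ℂ) (a : ℕ → ℝ)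
    (k : Fin M) :
    (Q + Qᴴ) *ᵥ measured V a Q ψ k = ((2 * x : ℝ) : ℂ) • measured V a Q ψ k := by
  have hQ : Q * Qᴴ = 1 := Matrix.mem_unitaryGroup_iff.mp h.unitary
  have hQ' : Qᴴ * Q = 1 := Matrix.mem_unitaryGroup_iff'.mp h.unitary
  have hcomm : ∀ t : ℕ, (Q + Qᴴ) * Q ^ t = Q ^ t * (Q + Qᴴ) := fun t =>
    (((Commute.refl Q).add_left (hQ'.trans hQ.symm : Commute Qᴴ Q)).pow_right t).eq
  simp only [measured, Matrix.mulVec_sum, Finset.smul_sum, Matrix.mulVec_smul]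
  refine Finset.sum_congr rfl fun t _ => ?_
  rw [Matrix.mulVec_mulVec, hcomm, ← Matrix.mulVec_mulVec, Matrix.add_mulVec, h.eigen,
    Matrix.mulVec_smul, smul_comm (a t : ℂ), smul_comm (star (V t k))]

/-- The mean square error of the measured value of `x`. -/
theorem second_moment (h : IsWalkVector Q ψ x) {V : Matrix (Fin M) (Fin M) ℂ}
    (hV : V ∈ Matrix.unitaryGroup (Fin M) ℂ) {ξ : Fin M → ℝ}
    (hξ : Vᴴ * pathMatrix M = Matrix.diagonal (fun t => (ξ t : ℂ)) * Vᴴ) {a : ℕ → ℝ}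
    (h0 : a 0 = 0) (hM : a M = 0) {c : ℝ} (hc : ∀ t < M, |a (t + 1) - a t| ≤ c) :
    ∑ k, (ξ k - x) ^ 2 * normSq (measured V a Q ψ k) ≤ M * c ^ 2 * normSq ψ := by
  set f : ℕ → Y → ℂ := fun t => Q ^ t *ᵥ ψ with hf
  -- This is J − x applied to the clock state; by `hkey` it becomes multiplication by `ξ k - x` in
  -- the measured basis.
  set g : Fin M → Y → ℂ := fun i =>
    ∑ j : Fin M, pathMatrix M i j • ((a j : ℂ) • f j) - (x : ℂ) • ((a i : ℂ) • f i) with hg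
  have hkey : ∀ k, ((ξ k - x : ℝ) : ℂ) • measured V a Q ψ k = ∑ t, star (V t k) • g t := by
    intro k
    have hrow : ∀ j, ∑ i, star (V i k) * pathMatrix M i j = ξ k * star (V j k) := by
      intro j
      have := congrFun (congrFun hξ k) j
      simpa [Matrix.mul_apply, Matrix.diagonal_apply] using this
    simp only [hg, smul_sub, Finset.sum_sub_distrib, Finset.smul_sum]
    rw [Finset.sum_comm]
    simp only [smul_smul _ (pathMatrix M _ _), ← Finset.sum_smul, hrow]
    simp only [measured, Complex.ofReal_sub, sub_smul, Finset.smul_sum, mul_smul]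
    rw [← Finset.sum_sub_distrib]
    refine Finset.sum_congr rfl fun t _ => ?_
    rw [smul_comm (x : ℂ)]
  have hgle : ∀ i, normSq (g i) ≤ c ^ 2 * normSq ψ := by
    intro i
    have hsq : ∀ t < M, (a (t + 1) - a t) ^ 2 ≤ c ^ 2 := fun t ht => by
      rw [← sq_abs]; exact pow_le_pow_left₀ (abs_nonneg _) (hc t ht) 2
    -- Inserting the recursion for x Q^i ψ leaves only increments of `a`. Row 0 has no left
    -- neighbour and needs `a 0 = 0` instead.
    have hgi : g i = (1 / 2 : ℂ) • (((a (i + 1) - a i : ℝ) : ℂ) • f (i + 1) +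
        if (i : ℕ) = 0 then 0 else ((a (i - 1) - a i : ℝ) : ℂ) • f (i - 1)) := by
      simp only [hg]
      rw [sum_pathMatrix_smul (h := fun j => (a j : ℂ) • f j) (by simp [hM])]
      rcases hi : (i : ℕ) with _ | t
      · simp [h0]
      · have hr := h.pow_succ_succ t
        have hr' : (x : ℂ) • f (t + 1) = (1 / 2 : ℂ) • (f (t + 2) + f t) := by
          simp only [hf]
          rw [← hr, smul_smul]; push_cast; congr 1; ring
        rw [smul_comm (x : ℂ), hr']
        simp only [Nat.add_eq_zero_iff, one_ne_zero, and_false, if_false, Nat.add_sub_cancel]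
        push_cast
        module
    have hsum : ∀ v w : Y → ℂ, normSq ((1 / 2 : ℂ) • (v + w)) ≤ (normSq v + normSq w) / 2 := by
      intro v w
      simp only [normSq, ← Finset.sum_add_distrib, Finset.sum_div]
      refine Finset.sum_le_sum fun y _ => ?_
      have h1 := norm_add_le (v y) (w y)
      simp only [Pi.smul_apply, Pi.add_apply, norm_smul]
      norm_num
      nlinarith [norm_nonneg (v y + w y), sq_nonneg (‖v y‖ - ‖w y‖), norm_nonneg (v y),
        norm_nonneg (w y)]
    have hterm : ∀ (b : ℝ) (t : ℕ), b ^ 2 ≤ c ^ 2 →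
        normSq ((b : ℂ) • f t) ≤ c ^ 2 * normSq ψ := fun b t hb => by
      rw [normSq_smul, normSq_mulVec (pow_mem h.unitary _), Complex.norm_real, Real.norm_eq_abs,
        sq_abs]
      exact mul_le_mul_of_nonneg_right hb (normSq_nonneg _)
    rw [hgi]
    refine (hsum _ _).trans ?_
    have t1 := hterm _ (i + 1) (hsq i i.2)
    rcases hi : (i : ℕ) with _ | t
    · rw [hi] at t1
      have : 0 ≤ c ^ 2 * normSq ψ := mul_nonneg (sq_nonneg _) (normSq_nonneg _)
      simp only [if_true]
      have hz : normSq (0 : Y → ℂ) = 0 := by simp [normSq]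
      linarith
    · rw [hi] at t1
      have t2 := hterm (a t - a (t + 1)) t (by
        have := hsq t (by have := i.2; omega)
        linarith [sq_nonneg (a t - a (t + 1)), (by ring :
          (a t - a (t + 1)) ^ 2 = (a (t + 1) - a t) ^ 2)])
      simp only [Nat.add_eq_zero_iff, one_ne_zero, and_false, if_false, Nat.add_sub_cancel]
      linarith
  calc ∑ k, (ξ k - x) ^ 2 * normSq (measured V a Q ψ k)
      = ∑ k, normSq (∑ t, star (V t k) • g t) := by
        refine Finset.sum_congr rfl fun k _ => ?_
        rw [← hkey, normSq_smul, Complex.norm_real, Real.norm_eq_abs, sq_abs]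
    _ = ∑ t, normSq (g t) := sum_normSq_sum_smul hV g
    _ ≤ ∑ _t : Fin M, c ^ 2 * normSq ψ := Finset.sum_le_sum fun t _ => hgle t
    _ = M * c ^ 2 * normSq ψ := by simp [mul_assoc]

end IsWalkVector

/-- The amplitudes of the clock. -/
noncomputable def sineWindow (M t : ℕ) : ℝ := Real.sqrt (2 / M) * Real.sin (Real.pi * t / M)

theorem sineWindow_zero (M : ℕ) : sineWindow M 0 = 0 := by simp [sineWindow]

theorem sineWindow_self (M : ℕ) : sineWindow M M = 0 := by
  rcases Nat.eq_zero_or_pos M with rfl | hM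
  · simp [sineWindow]
  · have : (M : ℝ) ≠ 0 := by positivity
    simp [sineWindow, mul_div_assoc, div_self this]

theorem abs_sineWindow_succ_sub_le (M t : ℕ) :
    |sineWindow M (t + 1) - sineWindow M t| ≤ Real.sqrt (2 / M) * (Real.pi / M) := by
  rw [sineWindow, sineWindow, ← mul_sub, abs_mul, abs_of_nonneg (Real.sqrt_nonneg _)]
  refine mul_le_mul_of_nonneg_left ?_ (Real.sqrt_nonneg _)
  refine (Real.abs_sin_sub_sin_le _ _).trans (le_of_eq ?_)
  rw [abs_of_nonneg] <;> push_cast <;> ring_nf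
  positivity

/-- The angles at the times t and t + K differ by π/2, so the squares pair up to sin² + cos² = 1. -/
theorem sum_sineWindow_sq {K : ℕ} (hK : 0 < K) :
    ∑ t : Fin (2 * K), sineWindow (2 * K) t ^ 2 = 1 := by
  have hK' : (K : ℝ) ≠ 0 := by positivity
  rw [Fin.sum_univ_eq_sum_range (fun t => sineWindow (2 * K) t ^ 2) (2 * K), two_mul,
    Finset.sum_range_add, ← Finset.sum_add_distrib]
  have : ∀ t ∈ Finset.range K, sineWindow (K + K) t ^ 2 + sineWindow (K + K) (K + t) ^ 2 =
      1 / K := by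
    intro t _
    have h1 : Real.pi * ((K + t : ℕ) : ℝ) / ((K + K : ℕ) : ℝ) =
        Real.pi * t / ((K + K : ℕ) : ℝ) + Real.pi / 2 := by
      push_cast; field_simp; ring
    rw [sineWindow, sineWindow, h1, Real.sin_add_pi_div_two, mul_pow, mul_pow,
      Real.sq_sqrt (by positivity), ← mul_add, Real.sin_sq_add_cos_sq]
    push_cast; field_simp; ring
  rw [Finset.sum_congr rfl this]
  simp [hK']

end Clock

/-! ### Walk operators -/

section Walk

variable {Y V : Type*}

/-- The reflection about the range of an isometry. -/
noncomputable def reflection [DecidableEq Y] [Fintype V] (ι : Matrix Y V ℂ) : Matrix Y Y ℂ :=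
  (2 : ℂ) • (ι * ιᴴ) - 1

theorem mem_unitaryGroup_of_involution [Fintype Y] [DecidableEq Y] {A : Matrix Y Y ℂ}
    (h : Aᴴ = A) (h2 : A * A = 1) :
    A ∈ Matrix.unitaryGroup Y ℂ := by
  rw [Matrix.mem_unitaryGroup_iff, Matrix.star_eq_conjTranspose, h, h2]

theorem conjTranspose_reflection [DecidableEq Y] [Fintype V] (ι : Matrix Y V ℂ) :
    (reflection ι)ᴴ = reflection ι := by
  simp [reflection, Matrix.conjTranspose_sub, Matrix.conjTranspose_smul, Matrix.conjTranspose_mul]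

variable [Fintype Y] [Fintype V] [DecidableEq V]

theorem normSq_isometry_mulVec {ι : Matrix Y V ℂ} (hι : ιᴴ * ι = 1) (q : V → ℂ) :
    normSq (ι *ᵥ q) = normSq q := by
  have : (normSq (ι *ᵥ q) : ℂ) = normSq q := by
    rw [ofReal_normSq, ofReal_normSq, Matrix.star_mulVec, ← Matrix.dotProduct_mulVec,
      Matrix.mulVec_mulVec, hι, Matrix.one_mulVec]
  exact_mod_cast this

variable [DecidableEq Y]

theorem reflection_mul_isometry {ι : Matrix Y V ℂ} (hι : ιᴴ * ι = 1) : reflection ι * ι = ι := by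
  rw [reflection, Matrix.sub_mul, Matrix.one_mul, Matrix.smul_mul, Matrix.mul_assoc, hι,
    Matrix.mul_one, two_smul, add_sub_cancel_right]

theorem reflection_mul_self {ι : Matrix Y V ℂ} (hι : ιᴴ * ι = 1) :
    reflection ι * reflection ι = 1 := by
  conv_lhs => enter [2]; rw [reflection]
  rw [Matrix.mul_sub, Matrix.mul_smul, ← Matrix.mul_assoc, reflection_mul_isometry hι,
    Matrix.mul_one, reflection]
  abel

/-- An eigenvector of the matrix that is encoded by a Hermitian involution `U` in the range of
`ι` is a walk vector. -/
theorem isWalkVector_reflection_mul {ι : Matrix Y V ℂ} (hι : ιᴴ * ι = 1) {U : Matrix Y Y ℂ}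
    (hU : Uᴴ = U) (hU2 : U * U = 1) {q : V → ℂ} {x : ℝ}
    (hq : (ιᴴ * U * ι) *ᵥ q = (x : ℂ) • q) :
    IsWalkVector (reflection ι * U) (ι *ᵥ q) x where
  unitary := mul_mem
    (mem_unitaryGroup_of_involution (conjTranspose_reflection ι) (reflection_mul_self hι))
    (mem_unitaryGroup_of_involution hU hU2)
  eigen := by
    rw [Matrix.conjTranspose_mul, hU, conjTranspose_reflection, Matrix.mulVec_mulVec,
      Matrix.mulVec_mulVec, Matrix.mul_assoc U, reflection_mul_isometry hι, ← Matrix.add_mulVec]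
    -- `reflection ι + 1` is twice the projection `ι * ιᴴ`.
    have : reflection ι * U * ι + U * ι = (2 : ℂ) • (ι * (ιᴴ * U * ι)) := by
      rw [reflection, Matrix.sub_mul, Matrix.sub_mul, Matrix.one_mul, sub_add_cancel]
      simp only [Matrix.smul_mul, Matrix.mul_assoc]
    rw [this, Matrix.smul_mulVec, ← Matrix.mulVec_mulVec, hq, Matrix.mulVec_smul, smul_smul]
    push_cast; rfl

end Walk

/-! ### Product vectors -/

section Tensor

/-- The product of two vectors. -/
def tens {F P : Type} (f : F → ℂ) (g : P → ℂ) : F × P → ℂ := fun y => f y.1 * g y.2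

theorem ket_prod {F P : Type} [DecidableEq F] [DecidableEq P] (b : F) (p : P) :
    ket (b, p) = tens (ket b) (ket p) := by
  ext ⟨b', p'⟩
  simp only [ket, tens, Pi.single_apply, Prod.mk.injEq, mul_ite, mul_one, mul_zero]
  split_ifs <;> simp_all

theorem tens_smul_sum {F P ι : Type} (f : F → ℂ) (c : ℂ) (s : Finset ι) (g : ι → P → ℂ) :
    tens f (c • ∑ i ∈ s, g i) = c • ∑ i ∈ s, tens f (g i) := by
  ext y
  simp only [tens, Pi.smul_apply, Finset.sum_apply, smul_eq_mul, Finset.mul_sum]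
  exact Finset.sum_congr rfl fun i _ => by ring

theorem smul_sum_tens {F P ι : Type} (c : ℂ) (s : Finset ι) (g : ι → F → ℂ) (f : P → ℂ) :
    tens (c • ∑ i ∈ s, g i) f = c • ∑ i ∈ s, tens (g i) f := by
  ext y
  simp only [tens, Pi.smul_apply, Finset.sum_apply, smul_eq_mul, Finset.mul_sum, Finset.sum_mul]
  exact Finset.sum_congr rfl fun i _ => by ring

theorem kronecker_mulVec_tens {F P : Type} [Fintype F] [Fintype P] (A : Matrix F F ℂ)
    (B : Matrix P P ℂ) (f : F → ℂ) (g : P → ℂ) :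
    (A ⊗ₖ B) *ᵥ tens f g = tens (A *ᵥ f) (B *ᵥ g) := by
  ext ⟨b, p⟩
  simp only [Matrix.mulVec, dotProduct, tens, Matrix.kroneckerMap_apply, Fintype.sum_prod_type,
    Finset.sum_mul_sum]
  exact Finset.sum_congr rfl fun i _ => Finset.sum_congr rfl fun j _ => by ring

theorem star_tens_dotProduct {F P : Type} [Fintype F] [Fintype P] (f f' : F → ℂ) (g g' : P → ℂ) :
    star (tens f g) ⬝ᵥ tens f' g' = (star f ⬝ᵥ f') * (star g ⬝ᵥ g') := by
  simp only [dotProduct, tens, Pi.star_apply, Fintype.sum_prod_type, Finset.sum_mul_sum, star_mul']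
  exact Finset.sum_congr rfl fun i _ => Finset.sum_congr rfl fun j _ => by ring

theorem star_ket_dotProduct_ket {P : Type} [Fintype P] [DecidableEq P] (p p' : P) :
    star (ket p) ⬝ᵥ ket p' = if p = p' then 1 else 0 := by
  simp only [ket, dotProduct, Pi.star_apply, Pi.single_apply]
  simp [apply_ite, eq_comm]

theorem mulVec_ket_apply {P Q : Type} [Fintype P] [DecidableEq P] (A : Matrix Q P ℂ) (p : P)
    (q : Q) : (A *ᵥ ket p) q = A q p := by
  simp [ket]

end Tensor

/-! ### Encoding of a sparse matrix -/

section Encoding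

variable {n r : ℕ}

/-- The registers of the oracles together with a flag qubit. -/
abbrev WalkBasis (n r : ℕ) : Type := Bool × AngleBasis n r

/-- The basis state of the vertex `v` with all other registers zero. -/
def origin (n r : ℕ) (v : Bits n) : WalkBasis n r := (false, ((v, zeros n), (zeros r, false)))

/-- The isometry `|v⟩ ↦ |v⟩|0⟩`. -/
noncomputable def embed (n r : ℕ) : Matrix (WalkBasis n r) (Bits n) ℂ :=
  Matrix.of fun y v => ket (origin n r v) y

theorem embed_mulVec_ket (v : Bits n) : embed n r *ᵥ ket v = ket (origin n r v) := by
  ext y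
  rw [mulVec_ket_apply]
  rfl

theorem embed_isometry : (embed n r)ᴴ * embed n r = 1 := by
  ext u v
  have := star_ket_dotProduct_ket (origin n r u) (origin n r v)
  have hinj : origin n r u = origin n r v ↔ u = v :=
    ⟨fun h => congrArg (fun y => y.2.1.1) h, fun h => h ▸ rfl⟩
  rw [Matrix.one_apply]
  simp only [hinj] at this
  rw [← this]
  rfl

theorem embed_compress_apply (U : Matrix (WalkBasis n r) (WalkBasis n r) ℂ) (u v : Bits n) :
    ((embed n r)ᴴ * U * embed n r) u v = star (ket (origin n r u)) ⬝ᵥ U *ᵥ ket (origin n r v) := by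
  rw [Matrix.mul_assoc, ← embed_mulVec_ket v, Matrix.mulVec_mulVec]
  simp only [Matrix.mul_apply, dotProduct, mulVec_ket_apply]
  rfl

/-- The exchange of the two vertex registers. -/
noncomputable def vertexSwap (n : ℕ) : Matrix (PosBasis n) (PosBasis n) ℂ :=
  Matrix.of fun p q => ket p.swap q

theorem vertexSwap_mulVec_ket (u v : Bits n) : vertexSwap n *ᵥ ket (u, v) = ket (v, u) := by
  ext ⟨p, q⟩
  rw [mulVec_ket_apply]
  simp [vertexSwap, ket, Pi.single_apply, and_comm, eq_comm]

theorem conjTranspose_vertexSwap : (vertexSwap n)ᴴ = vertexSwap n := by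
  ext ⟨p, q⟩ ⟨p', q'⟩
  simp [vertexSwap, ket, Pi.single_apply, apply_ite, and_comm, eq_comm]

theorem vertexSwap_mul_self : vertexSwap n * vertexSwap n = 1 := by
  refine Matrix.ext_of_mulVec_single fun ⟨u, v⟩ => ?_
  change _ *ᵥ ket (u, v) = _ *ᵥ ket (u, v)
  rw [← Matrix.mulVec_mulVec, vertexSwap_mulVec_ket, vertexSwap_mulVec_ket, Matrix.one_mulVec]

/-- The sign of the flag. -/
noncomputable def flagSign : Matrix Bool Bool ℂ := Matrix.diagonal fun b => if b then -1 else 1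

/-- The involution that exchanges the vertex registers and applies the sign of the flag. -/
noncomputable def flagSwap (n r : ℕ) : Matrix (WalkBasis n r) (WalkBasis n r) ℂ :=
  flagSign ⊗ₖ (vertexSwap n ⊗ₖ (1 : Matrix (Bits r × Bool) (Bits r × Bool) ℂ))

theorem conjTranspose_flagSwap : (flagSwap n r)ᴴ = flagSwap n r := by
  have h : flagSignᴴ = flagSign := by
    rw [flagSign, Matrix.diagonal_conjTranspose]
    congr 1
    ext b
    cases b <;> simp
  rw [flagSwap, Matrix.conjTranspose_kronecker, Matrix.conjTranspose_kronecker, h,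
    conjTranspose_vertexSwap, Matrix.conjTranspose_one]

theorem flagSwap_mul_self : flagSwap n r * flagSwap n r = 1 := by
  have h : flagSign * flagSign = 1 := by
    rw [flagSign, Matrix.diagonal_mul_diagonal, ← Matrix.diagonal_one]
    congr 1
    ext b
    cases b <;> simp
  rw [flagSwap, ← Matrix.mul_kronecker_mul, ← Matrix.mul_kronecker_mul, h, vertexSwap_mul_self,
    one_mul, Matrix.one_kronecker_one, Matrix.one_kronecker_one]

/-- A state of the flag in which its sign has the mean `h`. -/
noncomputable def flagState (h : ℝ) : Bool → ℂ := fun b =>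
  (Real.sqrt ((1 + if b then -h else h) / 2) : ℂ)

theorem normSq_flagState {h : ℝ} (h1 : |h| ≤ 1) : normSq (flagState h) = 1 := by
  have := abs_le.mp h1
  simp only [normSq, flagState, Complex.norm_real, Real.norm_eq_abs, sq_abs, Fintype.sum_bool]
  rw [Real.sq_sqrt, Real.sq_sqrt] <;> simp <;> linarith

theorem flagState_sign_mean {h : ℝ} (h1 : |h| ≤ 1) :
    star (flagState h) ⬝ᵥ flagSign *ᵥ flagState h = h := by
  have := abs_le.mp h1
  have e : ∀ y : ℝ, 0 ≤ y → (Real.sqrt y : ℂ) * Real.sqrt y = y := fun y hy => by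
    rw [← Complex.ofReal_mul, Real.mul_self_sqrt hy]
  simp only [dotProduct, flagSign, Matrix.mulVec_diagonal, flagState, Pi.star_apply,
    Fintype.sum_bool, Complex.star_def, Complex.conj_ofReal, if_true, Bool.false_eq_true, if_false,
    neg_mul, one_mul, mul_neg]
  rw [e _ (by linarith), e _ (by linarith)]
  push_cast
  ring

/-- The matrix entry (in units of the maximum norm) that an angle and a sign stand for. -/
noncomputable def entryValue (dec : Bits r → ℝ) (a : Bits r × Bool) : ℝ :=
  (if a.2 then -1 else 1) * Real.cos (dec a.1) ^ 2

theorem abs_entryValue_le (dec : Bits r → ℝ) (a : Bits r × Bool) : |entryValue dec a| ≤ 1 := by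
  rw [entryValue, abs_mul, abs_of_nonneg (sq_nonneg (Real.cos _))]
  have := Real.cos_sq_le_one (dec a.1)
  split_ifs <;> simpa

theorem blockDiagonal_mem_unitaryGroup {F T : Type} [Fintype F] [DecidableEq F] [Fintype T]
    [DecidableEq T] {A : T → Matrix F F ℂ} (h : ∀ t, A t ∈ Matrix.unitaryGroup F ℂ) :
    Matrix.blockDiagonal A ∈ Matrix.unitaryGroup (F × T) ℂ := by
  rw [Matrix.mem_unitaryGroup_iff, Matrix.star_eq_conjTranspose,
    Matrix.blockDiagonal_conjTranspose, ← Matrix.blockDiagonal_mul, ← Matrix.blockDiagonal_one]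
  congr 1
  ext1 t
  exact Matrix.mem_unitaryGroup_iff.mp (h t)

/-- The rotation of the flag that is controlled by the angle and sign registers. -/
theorem exists_flagRotation (n : ℕ) (dec : Bits r → ℝ) :
    ∃ G : Matrix.unitaryGroup (WalkBasis n r) ℂ, ∀ p : AngleBasis n r,
      (G : Matrix (WalkBasis n r) (WalkBasis n r) ℂ) *ᵥ ket (false, p) =
        tens (flagState (entryValue dec p.2)) (ket p) := by
  choose g hg using fun p : AngleBasis n r =>
    exists_unitary_mulVec_ket false (normSq_flagState (abs_entryValue_le dec p.2))
  refine ⟨⟨_, blockDiagonal_mem_unitaryGroup fun p => (g p).2⟩, fun p => ?_⟩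
  ext ⟨b, q⟩
  rw [mulVec_ket_apply, ← hg p]
  change Matrix.blockDiagonal (fun p => (g p : Matrix Bool Bool ℂ)) (b, q) (false, p) = _
  rw [Matrix.blockDiagonal_apply]
  simp only [tens, ket, Pi.single_apply, mul_ite, mul_one, mul_zero]
  split_ifs with h
  · subst h
    exact (mulVec_ket_apply _ _ _).symm
  · rfl

/-- The gate that prepares the state of a row: the rotation of the flag by the angle that the
oracles compute. -/
noncomputable def rowGate (G : Matrix.unitaryGroup (WalkBasis n r) ℂ)
    (OP : Matrix.unitaryGroup (PosBasis n) ℂ) (OA : Matrix.unitaryGroup (AngleBasis n r) ℂ) :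
    Matrix (WalkBasis n r) (WalkBasis n r) ℂ :=
  ((1 : Matrix Bool Bool ℂ) ⊗ₖ (OA : Matrix (AngleBasis n r) (AngleBasis n r) ℂ)ᴴ) *
    ((G : Matrix (WalkBasis n r) (WalkBasis n r) ℂ) *
      (((1 : Matrix Bool Bool ℂ) ⊗ₖ (OA : Matrix (AngleBasis n r) (AngleBasis n r) ℂ)) *
        ((1 : Matrix Bool Bool ℂ) ⊗ₖ ((OP : Matrix (PosBasis n) (PosBasis n) ℂ) ⊗ₖ
          (1 : Matrix (Bits r × Bool) (Bits r × Bool) ℂ)))))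

theorem conjTranspose_mul_coe {Y : Type*} [Fintype Y] [DecidableEq Y]
    (A : Matrix.unitaryGroup Y ℂ) : (A : Matrix Y Y ℂ)ᴴ * (A : Matrix Y Y ℂ) = 1 :=
  Matrix.mem_unitaryGroup_iff'.mp A.2

theorem mul_conjTranspose_coe {Y : Type*} [Fintype Y] [DecidableEq Y]
    (A : Matrix.unitaryGroup Y ℂ) : (A : Matrix Y Y ℂ) * (A : Matrix Y Y ℂ)ᴴ = 1 :=
  Matrix.mem_unitaryGroup_iff.mp A.2

theorem rowGate_mem_unitaryGroup (G : Matrix.unitaryGroup (WalkBasis n r) ℂ)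
    (OP : Matrix.unitaryGroup (PosBasis n) ℂ) (OA : Matrix.unitaryGroup (AngleBasis n r) ℂ) :
    rowGate G OP OA ∈ Matrix.unitaryGroup (WalkBasis n r) ℂ :=
  mul_mem (Matrix.kronecker_mem_unitary (one_mem _) (Unitary.star_mem OA.2)) <|
    mul_mem G.2 <| mul_mem (Matrix.kronecker_mem_unitary (one_mem _) OA.2) <|
      Matrix.kronecker_mem_unitary (one_mem _) (Matrix.kronecker_mem_unitary OP.2 (one_mem _))

/-- The oracles encode the matrix with the entries `h u v`. -/
structure Encodes (dec : Bits r → ℝ) (s : ℕ) (nbhd : Bits n → Finset (Bits n))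
    (h : Bits n → Bits n → ℝ) (θ : Bits n → Bits n → Bits r × Bool)
    (OP : Matrix.unitaryGroup (PosBasis n) ℂ) (OA : Matrix.unitaryGroup (AngleBasis n r) ℂ) :
    Prop where
  pos : IsPositionOracle s nbhd OP
  angle : ∀ u v, (OA : Matrix (AngleBasis n r) (AngleBasis n r) ℂ) *ᵥ
    ket ((u, v), (zeros r, false)) = ket ((u, v), θ u v)
  value : ∀ u v, entryValue dec (θ u v) = h u v
  symm : ∀ u v, h u v = h v u
  support : ∀ u v, v ∉ nbhd u → h u v = 0

variable {dec : Bits r → ℝ} {s : ℕ} {nbhd : Bits n → Finset (Bits n)}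
  {h : Bits n → Bits n → ℝ} {θ : Bits n → Bits n → Bits r × Bool}
  {OP : Matrix.unitaryGroup (PosBasis n) ℂ} {OA : Matrix.unitaryGroup (AngleBasis n r) ℂ}
  {G : Matrix.unitaryGroup (WalkBasis n r) ℂ}

/-- The inverse angle query resets the angle and sign registers. Without this, the values left in
them could affect the overlap of two row states. -/
theorem rowGate_mulVec_origin (he : Encodes dec s nbhd h θ OP OA)
    (hG : ∀ p : AngleBasis n r, (G : Matrix (WalkBasis n r) (WalkBasis n r) ℂ) *ᵥ ket (false, p) =
      tens (flagState (entryValue dec p.2)) (ket p)) (u : Bits n) :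
    rowGate G OP OA *ᵥ ket (origin n r u) = ((Real.sqrt s : ℂ))⁻¹ •
      ∑ v ∈ nbhd u, tens (flagState (h u v)) (ket ((u, v), (zeros r, false))) := by
  have hinv : ∀ v, (OA : Matrix (AngleBasis n r) (AngleBasis n r) ℂ)ᴴ *ᵥ ket ((u, v), θ u v) =
      ket ((u, v), (zeros r, false)) := fun v => by
    rw [← he.angle, Matrix.mulVec_mulVec, conjTranspose_mul_coe, Matrix.one_mulVec]
  simp only [rowGate, ← Matrix.mulVec_mulVec]
  have hpos : (((OP : Matrix (PosBasis n) (PosBasis n) ℂ) ⊗ₖ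
      (1 : Matrix (Bits r × Bool) (Bits r × Bool) ℂ)) *ᵥ ket ((u, zeros n), (zeros r, false))) =
        ((Real.sqrt s : ℂ))⁻¹ • ∑ v ∈ nbhd u, ket ((u, v), (zeros r, false)) := by
    rw [ket_prod, kronecker_mulVec_tens, he.pos, Matrix.one_mulVec, smul_sum_tens]
    simp only [ket_prod]
  rw [origin, ket_prod false, kronecker_mulVec_tens _ _ (ket false), hpos, Matrix.one_mulVec,
    tens_smul_sum]
  simp only [← ket_prod, Matrix.mulVec_smul, Matrix.mulVec_sum]
  congr 1
  refine Finset.sum_congr rfl fun v _ => ?_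
  rw [ket_prod false, kronecker_mulVec_tens, he.angle, Matrix.one_mulVec, ← ket_prod, hG,
    kronecker_mulVec_tens, hinv, Matrix.one_mulVec, he.value]

/-- The Hermitian involution that encodes the matrix. -/
noncomputable def blockEncoding (G : Matrix.unitaryGroup (WalkBasis n r) ℂ)
    (OP : Matrix.unitaryGroup (PosBasis n) ℂ) (OA : Matrix.unitaryGroup (AngleBasis n r) ℂ) :
    Matrix (WalkBasis n r) (WalkBasis n r) ℂ :=
  (rowGate G OP OA)ᴴ * (flagSwap n r * rowGate G OP OA)

theorem conjTranspose_blockEncoding :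
    (blockEncoding G OP OA)ᴴ = blockEncoding G OP OA := by
  rw [blockEncoding, Matrix.conjTranspose_mul, Matrix.conjTranspose_mul,
    Matrix.conjTranspose_conjTranspose, conjTranspose_flagSwap, Matrix.mul_assoc]

theorem blockEncoding_mul_self : blockEncoding G OP OA * blockEncoding G OP OA = 1 := by
  have h1 := mul_conjTranspose_coe ⟨_, rowGate_mem_unitaryGroup G OP OA⟩
  have h2 := conjTranspose_mul_coe ⟨_, rowGate_mem_unitaryGroup G OP OA⟩
  simp only at h1 h2
  rw [blockEncoding, mul_assoc, mul_assoc, ← mul_assoc (rowGate G OP OA), h1, one_mul,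
    ← mul_assoc (flagSwap n r), flagSwap_mul_self, one_mul, h2]

/-- After the exchange, the rows of u and v overlap only in the pair (u, v). By symmetry of the
matrix both carry the same flag state there, whose sign has mean `h u v`; the two normalizations
give the factor 1/s. -/
theorem embed_compress_blockEncoding (he : Encodes dec s nbhd h θ OP OA)
    (hG : ∀ p : AngleBasis n r, (G : Matrix (WalkBasis n r) (WalkBasis n r) ℂ) *ᵥ ket (false, p) =
      tens (flagState (entryValue dec p.2)) (ket p)) :
    (embed n r)ᴴ * blockEncoding G OP OA * embed n r =
      Matrix.of fun u v => ((h u v / s : ℝ) : ℂ) := by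
  ext u v
  have hle : ∀ u v, |h u v| ≤ 1 := fun u v => he.value u v ▸ abs_entryValue_le _ _
  have hs : ((Real.sqrt s : ℂ))⁻¹ * ((Real.sqrt s : ℂ))⁻¹ = (s : ℂ)⁻¹ := by
    rw [← mul_inv, ← Complex.ofReal_mul, Real.mul_self_sqrt (Nat.cast_nonneg s)]
    simp
  have hterm : ∀ w w', star (tens (flagState (h u w)) (ket ((u, w), (zeros r, false)))) ⬝ᵥ
      flagSwap n r *ᵥ tens (flagState (h v w')) (ket ((v, w'), (zeros r, false))) =
        if w = v then (if w' = u then (h u v : ℂ) else 0) else 0 := by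
    intro w w'
    rw [flagSwap, kronecker_mulVec_tens, ket_prod (v, w'), kronecker_mulVec_tens,
      vertexSwap_mulVec_ket, Matrix.one_mulVec, ← ket_prod, star_tens_dotProduct,
      star_ket_dotProduct_ket]
    by_cases hw : w = v
    · by_cases hw' : w' = u
      · subst hw hw'
        rw [he.symm w w', flagState_sign_mean (hle _ _)]
        simp
      · simp [hw, hw', Ne.symm hw']
    · simp [hw]
  rw [embed_compress_apply, blockEncoding, ← Matrix.mulVec_mulVec, ← Matrix.mulVec_mulVec,
    ← star_mulVec_dotProduct, rowGate_mulVec_origin he hG, rowGate_mulVec_origin he hG,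
    Matrix.mulVec_smul, star_smul, smul_dotProduct, dotProduct_smul, Matrix.mulVec_sum, star_sum,
    sum_dotProduct]
  simp only [dotProduct_sum, hterm, smul_eq_mul, Complex.star_def, map_inv₀, Complex.conj_ofReal,
    Matrix.of_apply]
  rw [← mul_assoc, hs]
  -- The padding by dummy vertices need not be symmetric; if one row lacks the pair, the entry is 0
  -- anyway.
  by_cases h1 : v ∈ nbhd u
  · by_cases h2 : u ∈ nbhd v
    · simp [h1, h2, div_eq_inv_mul]
    · have := he.support v u h2
      rw [he.symm] at this
      simp [this]
  · simp [he.support u v h1]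

end Encoding

/-! ### The circuit -/

section Circuit

set_option synthInstance.maxSize 2000

variable {n r : ℕ}

/-- The action of a query on the walk registers. -/
noncomputable def Query.walkGate (OP : Matrix.unitaryGroup (PosBasis n) ℂ)
    (OA : Matrix.unitaryGroup (AngleBasis n r) ℂ) :
    Query → Matrix (WalkBasis n r) (WalkBasis n r) ℂ
  | .pos => (1 : Matrix Bool Bool ℂ) ⊗ₖ ((OP : Matrix (PosBasis n) (PosBasis n) ℂ) ⊗ₖ
      (1 : Matrix (Bits r × Bool) (Bits r × Bool) ℂ))
  | .posInv => (1 : Matrix Bool Bool ℂ) ⊗ₖ ((OP : Matrix (PosBasis n) (PosBasis n) ℂ)ᴴ ⊗ₖ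
      (1 : Matrix (Bits r × Bool) (Bits r × Bool) ℂ))
  | .angle => (1 : Matrix Bool Bool ℂ) ⊗ₖ (OA : Matrix (AngleBasis n r) (AngleBasis n r) ℂ)
  | .angleInv => (1 : Matrix Bool Bool ℂ) ⊗ₖ (OA : Matrix (AngleBasis n r) (AngleBasis n r) ℂ)ᴴ

/-- The work qubits consist of the flag and the clock. -/
noncomputable def workEquiv (m : ℕ) : Bits (m + 1) ≃ Bool × Fin (2 ^ m) :=
  -- Any bijection will do: the preparation unitary comes from `exists_unitary_mulVec_ket`, whatever
  -- the coordinates of the all-zero string are.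
  Fintype.equivOfCardEq (by simp [pow_succ, mul_comm])

/-- The computer as walk registers and clock. -/
noncomputable def basisEquiv (n r m : ℕ) : Basis n r (m + 1) ≃ WalkBasis n r × Fin (2 ^ m) where
  toFun b := (((workEquiv m b.2).1, b.1), (workEquiv m b.2).2)
  invFun z := (z.1.2, (workEquiv m).symm (z.1.1, z.2))
  left_inv b := by simp
  right_inv z := by simp

/-- A query ignores the flag and acts in the same way at all times of the clock: queries are never
controlled. -/
theorem gate_eq_submatrix (m : ℕ) (OP : Matrix.unitaryGroup (PosBasis n) ℂ)
    (OA : Matrix.unitaryGroup (AngleBasis n r) ℂ) (q : Query) :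
    q.gate (m + 1) OP OA = (Matrix.blockDiagonal fun _ : Fin (2 ^ m) => q.walkGate OP OA).submatrix
      (basisEquiv n r m) (basisEquiv n r m) := by
  have key : ∀ A : Matrix (AngleBasis n r) (AngleBasis n r) ℂ,
      A ⊗ₖ (1 : Matrix (Bits (m + 1)) (Bits (m + 1)) ℂ) =
        (Matrix.blockDiagonal fun _ : Fin (2 ^ m) => (1 : Matrix Bool Bool ℂ) ⊗ₖ A).submatrix
          (basisEquiv n r m) (basisEquiv n r m) := by
    intro A
    ext ⟨p, x⟩ ⟨p', x'⟩
    have hx : x = x' ↔ (workEquiv m x).1 = (workEquiv m x').1 ∧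
        (workEquiv m x).2 = (workEquiv m x').2 := by
      rw [← Prod.ext_iff, (workEquiv m).apply_eq_iff_eq]
    simp only [Matrix.kroneckerMap_apply, Matrix.submatrix_apply, Matrix.blockDiagonal_apply,
      basisEquiv, Equiv.coe_fn_mk, Matrix.one_apply, hx]
    split_ifs <;> simp_all
  cases q <;> exact key _

/-- A unitary in other coordinates. -/
noncomputable def reindexUnitary {B Z : Type} [Fintype B] [DecidableEq B] [Fintype Z]
    [DecidableEq Z] (E : B ≃ Z) (A : Matrix.unitaryGroup Z ℂ) : Matrix.unitaryGroup B ℂ :=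
  ⟨(A : Matrix Z Z ℂ).submatrix E E, by
    rw [Matrix.mem_unitaryGroup_iff, Matrix.star_eq_conjTranspose, Matrix.conjTranspose_submatrix,
      Matrix.submatrix_mul_equiv, mul_conjTranspose_coe, Matrix.submatrix_one_equiv]⟩

/-- The state with the component `φ t` at the time `t` of the clock. -/
def glue {Y T : Type} (φ : T → Y → ℂ) : Y × T → ℂ := fun z => φ z.2 z.1

theorem blockDiagonal_mulVec_glue {Y T : Type} [Fintype Y] [Fintype T] [DecidableEq T]
    (A : T → Matrix Y Y ℂ) (φ : T → Y → ℂ) :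
    Matrix.blockDiagonal A *ᵥ glue φ = glue fun t => A t *ᵥ φ t := by
  ext ⟨y, t⟩
  simp only [Matrix.mulVec, dotProduct, glue, Fintype.sum_prod_type, Matrix.blockDiagonal_apply]
  refine Finset.sum_congr rfl fun y' _ => ?_
  simp

theorem one_kronecker_mulVec_glue {Y T : Type} [Fintype Y] [DecidableEq Y] [Fintype T]
    (A : Matrix T T ℂ) (φ : T → Y → ℂ) :
    ((1 : Matrix Y Y ℂ) ⊗ₖ A) *ᵥ glue φ = glue fun k => ∑ t, A k t • φ t := by
  ext ⟨y, k⟩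
  simp only [Matrix.mulVec, dotProduct, glue, Fintype.sum_prod_type, Matrix.kroneckerMap_apply,
    Matrix.one_apply, Finset.sum_apply, Pi.smul_apply, smul_eq_mul]
  rw [Finset.sum_eq_single y]
  · simp
  · intro y' _ hy
    simp [Ne.symm hy]
  · simp

variable {m : ℕ}

/-- A list of queries and unitaries acts on a state of the walk registers and the clock. -/
noncomputable def runSteps (OP : Matrix.unitaryGroup (PosBasis n) ℂ)
    (OA : Matrix.unitaryGroup (AngleBasis n r) ℂ)
    (l : List (Query × Matrix.unitaryGroup (WalkBasis n r × Fin (2 ^ m)) ℂ))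
    (ψ : WalkBasis n r × Fin (2 ^ m) → ℂ) : WalkBasis n r × Fin (2 ^ m) → ℂ :=
  l.foldl (fun ψ p =>
    (p.2 : Matrix (WalkBasis n r × Fin (2 ^ m)) (WalkBasis n r × Fin (2 ^ m)) ℂ) *ᵥ
    (Matrix.blockDiagonal (fun _ => p.1.walkGate OP OA) *ᵥ ψ)) ψ

theorem foldl_reindex_eq_runSteps (OP : Matrix.unitaryGroup (PosBasis n) ℂ)
    (OA : Matrix.unitaryGroup (AngleBasis n r) ℂ)
    (l : List (Query × Matrix.unitaryGroup (WalkBasis n r × Fin (2 ^ m)) ℂ))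
    (ψ : WalkBasis n r × Fin (2 ^ m) → ℂ) :
    (l.map fun p => (p.1, reindexUnitary (basisEquiv n r m) p.2)).foldl
      (fun ψ p => (p.2 : Matrix (Basis n r (m + 1)) (Basis n r (m + 1)) ℂ) *ᵥ
        (p.1.gate (m + 1) OP OA *ᵥ ψ)) (ψ ∘ basisEquiv n r m) =
      runSteps OP OA l ψ ∘ basisEquiv n r m := by
  induction l generalizing ψ with
  | nil => rfl
  | cons p l ih =>
    rw [List.map_cons, List.foldl_cons, runSteps, List.foldl_cons]
    have h : ∀ (A : Matrix (WalkBasis n r × Fin (2 ^ m)) (WalkBasis n r × Fin (2 ^ m)) ℂ)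
        (φ : WalkBasis n r × Fin (2 ^ m) → ℂ),
        A.submatrix (basisEquiv n r m) (basisEquiv n r m) *ᵥ (φ ∘ basisEquiv n r m) =
          (A *ᵥ φ) ∘ basisEquiv n r m := by
      intro A φ
      rw [Matrix.submatrix_mulVec_equiv]
      simp [Function.comp_assoc]
    rw [gate_eq_submatrix, h]
    change (List.foldl _ ((Matrix.submatrix _ _ _) *ᵥ _) _) = _
    rw [h, ih]
    rfl

/-- A unitary on the walk registers that is controlled by the clock. -/
noncomputable def clockControlled (A : Fin (2 ^ m) → Matrix.unitaryGroup (WalkBasis n r) ℂ) :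
    Matrix.unitaryGroup (WalkBasis n r × Fin (2 ^ m)) ℂ :=
  ⟨Matrix.blockDiagonal fun t => (A t : Matrix (WalkBasis n r) (WalkBasis n r) ℂ),
    blockDiagonal_mem_unitaryGroup fun t => (A t).2⟩

/-- `flagSwap` as a unitary. -/
noncomputable def flagSwapUnitary (n r : ℕ) : Matrix.unitaryGroup (WalkBasis n r) ℂ :=
  ⟨flagSwap n r, mem_unitaryGroup_of_involution conjTranspose_flagSwap flagSwap_mul_self⟩

/-- The reflection about the range of `embed` as a unitary. -/
noncomputable def reflectionUnitary (n r : ℕ) : Matrix.unitaryGroup (WalkBasis n r) ℂ :=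
  ⟨reflection (embed n r), mem_unitaryGroup_of_involution (conjTranspose_reflection _)
    (reflection_mul_self embed_isometry)⟩

/-- One step of the walk, at the times of the clock that are later than `k`. -/
noncomputable def walkSteps (m : ℕ) (G : Matrix.unitaryGroup (WalkBasis n r) ℂ) (k : ℕ) :
    List (Query × Matrix.unitaryGroup (WalkBasis n r × Fin (2 ^ m)) ℂ) :=
  [(.pos, 1), (.angle, clockControlled fun _ => G),
    (.angleInv, clockControlled fun t : Fin (2 ^ m) => if k < (t : ℕ) then
      flagSwapUnitary n r else 1),
    (.angle, clockControlled fun _ => G⁻¹), (.angleInv, 1),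
    (.posInv, clockControlled fun t : Fin (2 ^ m) => if k < (t : ℕ) then
      reflectionUnitary n r else 1)]

/-- The walk operator. -/
noncomputable def walk (G : Matrix.unitaryGroup (WalkBasis n r) ℂ)
    (OP : Matrix.unitaryGroup (PosBasis n) ℂ) (OA : Matrix.unitaryGroup (AngleBasis n r) ℂ) :
    Matrix (WalkBasis n r) (WalkBasis n r) ℂ :=
  reflection (embed n r) * blockEncoding G OP OA

variable (G : Matrix.unitaryGroup (WalkBasis n r) ℂ)
  (OP : Matrix.unitaryGroup (PosBasis n) ℂ) (OA : Matrix.unitaryGroup (AngleBasis n r) ℂ)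

theorem conjTranspose_rowGate : (rowGate G OP OA)ᴴ = Query.posInv.walkGate OP OA *
    (Query.angleInv.walkGate OP OA * ((G : Matrix (WalkBasis n r) (WalkBasis n r) ℂ)ᴴ *
      Query.angle.walkGate OP OA)) := by
  simp only [rowGate, Query.walkGate, Matrix.conjTranspose_mul, Matrix.conjTranspose_kronecker,
    Matrix.conjTranspose_one, Matrix.conjTranspose_conjTranspose, Matrix.mul_assoc]

/-- Only the flag exchange and the reflection depend on the clock. Where they are skipped, the row
gate cancels against its inverse, so six uncontrolled queries make a controlled step. -/
theorem runSteps_walkSteps (k : ℕ) (φ : Fin (2 ^ m) → WalkBasis n r → ℂ) :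
    runSteps OP OA (walkSteps m G k) (glue φ) =
      glue fun t : Fin (2 ^ m) => if k < (t : ℕ) then walk G OP OA *ᵥ φ t else φ t := by
  simp only [runSteps, walkSteps, List.foldl_cons, List.foldl_nil, clockControlled,
    blockDiagonal_mulVec_glue, Submonoid.coe_one, Matrix.one_mulVec]
  congr 1
  ext1 t
  split_ifs with hk
  · rw [walk, blockEncoding, conjTranspose_rowGate]
    simp only [rowGate, Matrix.mulVec_mulVec, Matrix.mul_assoc]
    rfl
  · have hR := conjTranspose_mul_coe ⟨_, rowGate_mem_unitaryGroup G OP OA⟩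
    simp only [conjTranspose_rowGate] at hR
    simp only [Submonoid.coe_one, Matrix.one_mul, Matrix.mulVec_mulVec]
    conv_rhs => rw [← Matrix.one_mulVec (φ t), ← hR]
    simp only [rowGate, Matrix.mul_assoc]
    rfl

theorem runSteps_append (l l' : List (Query × Matrix.unitaryGroup (WalkBasis n r × Fin (2 ^ m)) ℂ))
    (ψ : WalkBasis n r × Fin (2 ^ m) → ℂ) :
    runSteps OP OA (l ++ l') ψ = runSteps OP OA l' (runSteps OP OA l ψ) :=
  List.foldl_append

/-- Step k acts at the times later than k, so time t sees as many steps as there are k < K with k <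
t. -/
theorem runSteps_flatMap (K : ℕ) (φ : Fin (2 ^ m) → WalkBasis n r → ℂ) :
    runSteps OP OA ((List.range K).flatMap (walkSteps m G)) (glue φ) =
      glue fun t : Fin (2 ^ m) => walk G OP OA ^ (min (t : ℕ) K) *ᵥ φ t := by
  induction K with
  | zero => simp [runSteps]
  | succ K ih =>
    rw [List.range_succ, List.flatMap_append, runSteps_append, ih, List.flatMap_singleton,
      runSteps_walkSteps]
    congr 1
    ext1 t
    split_ifs with hk
    · rw [min_eq_right hk.le, min_eq_right hk, pow_succ', Matrix.mulVec_mulVec]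
    · rw [min_eq_left (by omega), min_eq_left (by omega)]

/-- The change of the basis of the clock before the measurement. -/
noncomputable def clockBasisChange (V : Matrix.unitaryGroup (Fin (2 ^ m)) ℂ) :
    Matrix.unitaryGroup (WalkBasis n r × Fin (2 ^ m)) ℂ :=
  ⟨(1 : Matrix (WalkBasis n r) (WalkBasis n r) ℂ) ⊗ₖ (V : Matrix (Fin (2 ^ m)) (Fin (2 ^ m)) ℂ)ᴴ,
    Matrix.kronecker_mem_unitary (one_mem _) (Unitary.star_mem V.2)⟩

/-- The two queries cancel; they are present because after the preparation every unitary has to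
follow a query. -/
theorem runSteps_clockBasisChange (V : Matrix.unitaryGroup (Fin (2 ^ m)) ℂ)
    (φ : Fin (2 ^ m) → WalkBasis n r → ℂ) :
    runSteps OP OA [(.pos, 1), (.posInv, clockBasisChange V)] (glue φ) =
      glue fun k => ∑ t, star (V t k) • φ t := by
  have h : Query.posInv.walkGate OP OA * Query.pos.walkGate OP OA = 1 := by
    simp only [Query.walkGate]
    rw [← Matrix.mul_kronecker_mul, ← Matrix.mul_kronecker_mul, conjTranspose_mul_coe, mul_one,
      mul_one, Matrix.one_kronecker_one, Matrix.one_kronecker_one]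
  simp only [runSteps, List.foldl_cons, List.foldl_nil, blockDiagonal_mulVec_glue,
    Submonoid.coe_one, Matrix.one_mulVec]
  simp only [Matrix.mulVec_mulVec _ (Query.posInv.walkGate OP OA), h, Matrix.one_mulVec,
    clockBasisChange, one_kronecker_mulVec_glue]
  rfl

/-- The initial state: the vertex `u`, and the amplitudes `a` of the clock. -/
noncomputable def initialState (n r m : ℕ) (u : Bits n) (a : ℕ → ℝ) : Basis n r (m + 1) → ℂ :=
  (glue fun t : Fin (2 ^ m) => (a t : ℂ) • ket (origin n r u)) ∘ basisEquiv n r m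

theorem normSq_ket {P : Type} [Fintype P] [DecidableEq P] (p : P) : normSq (ket p) = 1 := by
  have := ofReal_normSq (ket p)
  rw [star_ket_dotProduct_ket, if_pos rfl] at this
  exact_mod_cast this

theorem sum_comp_basisEquiv (f : WalkBasis n r × Fin (2 ^ m) → ℝ) :
    ∑ b, f (basisEquiv n r m b) = ∑ k, ∑ y, f (y, k) := by
  rw [Equiv.sum_comp (basisEquiv n r m) f, Fintype.sum_prod_type_right]

theorem normSq_initialState (u : Bits n) {a : ℕ → ℝ} (ha : ∑ t : Fin (2 ^ m), a t ^ 2 = 1) :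
    normSq (initialState n r m u a) = 1 := by
  have h : ∀ t : Fin (2 ^ m), normSq ((a t : ℂ) • ket (origin n r u)) = a t ^ 2 := fun t => by
    rw [normSq_smul, normSq_ket, Complex.norm_real, Real.norm_eq_abs, sq_abs, mul_one]
  rw [← ha, normSq]
  refine (sum_comp_basisEquiv fun z =>
    ‖glue (fun t : Fin (2 ^ m) => (a t : ℂ) • ket (origin n r u)) z‖ ^ 2).trans ?_
  exact Finset.sum_congr rfl fun t _ => h t

/-- Phase estimation for the walk, repeated `R` times. The clock is measured in the basis `V`. -/
noncomputable def phaseEstimator (m R : ℕ) (G : Matrix.unitaryGroup (WalkBasis n r) ℂ)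
    (V : Matrix.unitaryGroup (Fin (2 ^ m)) ℂ) (prep : Matrix.unitaryGroup (Basis n r (m + 1)) ℂ)
    (post : (Fin R → Fin (2 ^ m)) → List (ℝ × ℝ)) : QueryAlgorithm n r where
  work := m + 1
  prep := prep
  steps := ((List.range (2 ^ m)).flatMap (walkSteps m G) ++
    [(Query.pos, 1), (Query.posInv, clockBasisChange V)]).map
      fun p : Query × Matrix.unitaryGroup (WalkBasis n r × Fin (2 ^ m)) ℂ =>
        (p.1, reindexUnitary (basisEquiv n r m) p.2)
  runs := R
  post y := post fun i => (basisEquiv n r m (y i)).2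

theorem phaseEstimator_queries (m R : ℕ) (V : Matrix.unitaryGroup (Fin (2 ^ m)) ℂ)
    (prep : Matrix.unitaryGroup (Basis n r (m + 1)) ℂ)
    (post : (Fin R → Fin (2 ^ m)) → List (ℝ × ℝ)) :
    (phaseEstimator m R G V prep post).queries = R * (6 * 2 ^ m + 2) := by
  have h : ((List.range (2 ^ m)).flatMap (walkSteps m G)).length = 2 ^ m * 6 := by
    simp [List.length_flatMap, walkSteps]
  refine congrArg (R * ·) ((List.length_map _).trans ?_)
  rw [List.length_append, h, mul_comm 6]
  rfl

theorem phaseEstimator_finalState (R : ℕ) (V : Matrix.unitaryGroup (Fin (2 ^ m)) ℂ)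
    {prep : Matrix.unitaryGroup (Basis n r (m + 1)) ℂ}
    (post : (Fin R → Fin (2 ^ m)) → List (ℝ × ℝ)) {u : Bits n} {a : ℕ → ℝ}
    (hprep : (prep : Matrix (Basis n r (m + 1)) (Basis n r (m + 1)) ℂ) *ᵥ
      ket (((zeros n, zeros n), (zeros r, false)), zeros (m + 1)) = initialState n r m u a) :
    (phaseEstimator m R G V prep post).finalState OP OA =
      glue (measured V a (walk G OP OA) (ket (origin n r u))) ∘ basisEquiv n r m := by
  rw [QueryAlgorithm.finalState]
  refine (congrArg (fun ψ => List.foldl _ ψ _) hprep).trans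
    ((foldl_reindex_eq_runSteps OP OA _ _).trans ?_)
  rw [runSteps_append, runSteps_flatMap, runSteps_clockBasisChange]
  congr 2
  ext1 k
  refine Finset.sum_congr rfl fun t _ => ?_
  -- All times are below `2 ^ m`, so no power is cut off.
  rw [min_eq_left t.2.le, Matrix.mulVec_smul]

end Circuit

/-! ### Mixtures of concentrated distributions -/

section Mixture

/-- The events whose frequencies decide consistency. -/
noncomputable def spectralEvents (Δ ε : ℝ) (Λ : Finset ℝ) : Finset (Set ℝ) :=
  open Classical in
  Λ.image (fun x => {v | |v - x| < Δ / 4}) ∪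
    Λ.image (fun x => {v | |v - x| ≤ min (ε / 2) (Δ / 16)}) ∪ {{v | ∀ x ∈ Λ, Δ / 4 ≤ |v - x|}}

theorem card_spectralEvents_le (Δ ε : ℝ) (Λ : Finset ℝ) :
    (spectralEvents Δ ε Λ).card ≤ 2 * Λ.card + 1 := by
  classical
  refine (Finset.card_union_le _ _).trans (Nat.add_le_add ?_ (by simp))
  refine (Finset.card_union_le _ _).trans ?_
  rw [two_mul]
  exact Nat.add_le_add Finset.card_image_le Finset.card_image_le

variable {T : Type*} [Fintype T]

theorem mass_mono {p : T → ℝ} (hp : ∀ k, 0 ≤ p k) {E F : Set T} (h : E ⊆ F) :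
    mass p E ≤ mass p F :=
  Finset.sum_le_sum fun k _ => mul_le_mul_of_nonneg_left
    (Set.indicator_le_indicator_of_subset h (fun _ => zero_le_one) k) (hp k)

theorem mass_add_mass_compl (p : T → ℝ) (E : Set T) : mass p E + mass p Eᶜ = ∑ k, p k := by
  rw [mass, mass, ← Finset.sum_add_distrib]
  refine Finset.sum_congr rfl fun k _ => ?_
  by_cases h : k ∈ E <;> simp [h]

theorem mass_sum {ι : Type*} (s : Finset ι) (p : ι → T → ℝ) (E : Set T) :
    mass (fun k => ∑ x ∈ s, p x k) E = ∑ x ∈ s, mass (p x) E := by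
  simp only [mass, Finset.sum_mul]
  exact Finset.sum_comm

/-- Chebyshev's inequality. -/
theorem mass_far_le {p v : T → ℝ} (hp : ∀ k, 0 ≤ p k) {x τ b : ℝ} (hτ : 0 < τ)
    (h : ∑ k, (v k - x) ^ 2 * p k ≤ b) : mass p {k | τ ≤ |v k - x|} ≤ b / τ ^ 2 := by
  rw [le_div_iff₀ (by positivity), mass, Finset.sum_mul]
  refine le_trans (Finset.sum_le_sum fun k _ => ?_) h
  by_cases hk : τ ≤ |v k - x|
  · rw [Set.indicator_of_mem (by exact hk), mul_one, mul_comm, ← sq_abs (v k - x)]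
    exact mul_le_mul_of_nonneg_right (pow_le_pow_left₀ hτ.le hk 2) (hp k)
  · rw [Set.indicator_of_notMem (by exact hk), mul_zero, zero_mul]
    exact mul_nonneg (sq_nonneg _) (hp k)

/-- Chebyshev's inequality bounds the tail of each component by δ/64 times its own weight. Since the
weights sum to 1, all tails together stay below δ/64, however many atoms there are. The sampling
error adds another δ/64, which makes the δ/32 of `Consistent`. -/
theorem consistent_of_freq_close {R : ℕ} {Δ ε δ β : ℝ} (hΔ : 0 < Δ) (hε : 0 < ε)
    {Λ : Finset ℝ} {w : ℝ → ℝ} {v : T → ℝ} {p : ℝ → T → ℝ}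
    (gap : ∀ x ∈ Λ, ∀ x' ∈ Λ, |x - x'| < Δ → x = x') (hp : ∀ x k, 0 ≤ p x k)
    (hpw : ∀ x ∈ Λ, ∑ k, p x k = w x) (hw : ∑ x ∈ Λ, w x = 1)
    (hmom : ∀ x ∈ Λ, ∑ k, (v k - x) ^ 2 * p x k ≤ β * w x)
    (hβ₁ : β ≤ δ / 64 * (Δ / 4) ^ 2) (hβ₂ : β ≤ 1 / 4 * min (ε / 2) (Δ / 16) ^ 2)
    {z : Fin R → ℝ} (hz : ∀ S ∈ spectralEvents Δ ε Λ,
      |freq z S - mass (fun k => ∑ x ∈ Λ, p x k) (v ⁻¹' S)| ≤ δ / 64) :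
    Consistent Δ ε δ z Λ w := by
  have hw0 : ∀ x ∈ Λ, 0 ≤ w x := fun x hx => hpw x hx ▸ Finset.sum_nonneg fun k _ => hp x k
  have hw1 : ∀ x ∈ Λ, w x ≤ 1 := fun x hx => hw ▸ Finset.single_le_sum hw0 hx
  have hle : ∀ x ∈ Λ, ∀ E, mass (p x) E ≤ w x := fun x hx E => by
    rw [← hpw x hx, ← mass_add_mass_compl (p x) E]
    linarith [mass_nonneg (hp x) Eᶜ]
  have hfar : ∀ x ∈ Λ, mass (p x) {k | Δ / 4 ≤ |v k - x|} ≤ δ / 64 * w x := fun x hx => by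
    refine (mass_far_le (hp x) (by positivity) (hmom x hx)).trans ?_
    rw [div_le_iff₀ (by positivity)]
    linarith [mul_le_mul_of_nonneg_right hβ₁ (hw0 x hx)]
  have hρ : 0 < min (ε / 2) (Δ / 16) := lt_min (by positivity) (by positivity)
  have hpeak : ∀ x ∈ Λ, mass (p x) {k | min (ε / 2) (Δ / 16) ≤ |v k - x|} ≤ 1 / 4 * w x :=
    fun x hx => by
      refine (mass_far_le (hp x) hρ (hmom x hx)).trans ?_
      rw [div_le_iff₀ (by positivity)]
      linarith [mul_le_mul_of_nonneg_right hβ₂ (hw0 x hx)]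
  have hfarsum : ∑ x ∈ Λ, mass (p x) {k | Δ / 4 ≤ |v k - x|} ≤ δ / 64 := by
    refine (Finset.sum_le_sum hfar).trans (le_of_eq ?_)
    rw [← Finset.mul_sum, hw, mul_one]
  have hsingle : ∀ x ∈ Λ, ∀ E, mass (p x) E ≤ mass (fun k => ∑ x ∈ Λ, p x k) E :=
    fun x hx E => by
      rw [mass_sum]
      exact Finset.single_le_sum (f := fun x => mass (p x) E)
        (fun y _ => mass_nonneg (hp y) E) hx
  have hδ : 0 ≤ δ / 64 := le_trans (Finset.sum_nonneg fun x _ => mass_nonneg (hp x) _) hfarsum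
  refine ⟨gap, fun x hx => ?_, ?_, fun x hx => ?_⟩
  · have hev := abs_le.mp (hz {v | |v - x| < Δ / 4} (by
      simp only [spectralEvents, Finset.mem_union, Finset.mem_image]
      exact Or.inl (Or.inl ⟨x, hx, rfl⟩)))
    have hlow : w x - δ / 64 ≤ mass (p x) (v ⁻¹' {v | |v - x| < Δ / 4}) := by
      have h1 := mass_add_mass_compl (p x) {k | Δ / 4 ≤ |v k - x|}
      have h2 : {k | Δ / 4 ≤ |v k - x|}ᶜ = v ⁻¹' {v | |v - x| < Δ / 4} := by
        ext k; simp
      rw [h2, hpw x hx] at h1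
      have h3 := mul_le_mul_of_nonneg_left (hw1 x hx) hδ
      linarith [hfar x hx]
    have hup : mass (fun k => ∑ x ∈ Λ, p x k) (v ⁻¹' {v | |v - x| < Δ / 4}) ≤ w x + δ / 64 := by
      rw [mass_sum]
      -- By the gap, a value within Δ/4 of `x` lies in the tail of every other atom.
      calc ∑ y ∈ Λ, mass (p y) (v ⁻¹' {v | |v - x| < Δ / 4})
          ≤ ∑ y ∈ Λ, ((if y = x then w x else 0) + mass (p y) {k | Δ / 4 ≤ |v k - y|}) := by
            refine Finset.sum_le_sum fun y hy => ?_
            split_ifs with hyx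
            · subst hyx
              linarith [hle y hy (v ⁻¹' {v | |v - y| < Δ / 4}),
                mass_nonneg (hp y) {k | Δ / 4 ≤ |v k - y|}]
            · rw [zero_add]
              refine mass_mono (hp y) fun k hk => ?_
              simp only [Set.mem_preimage, Set.mem_ofPred_eq] at hk ⊢
              by_contra! hlt
              refine hyx (gap y hy x hx ?_)
              rw [abs_lt] at hk hlt ⊢
              constructor <;> linarith
        _ = w x + ∑ y ∈ Λ, mass (p y) {k | Δ / 4 ≤ |v k - y|} := by
            rw [Finset.sum_add_distrib, Finset.sum_ite_eq', if_pos hx]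
        _ ≤ w x + δ / 64 := by linarith
    have := hsingle x hx (v ⁻¹' {v | |v - x| < Δ / 4})
    exact abs_le.mpr ⟨by linarith, by linarith⟩
  · have hev := abs_le.mp (hz {v | ∀ x ∈ Λ, Δ / 4 ≤ |v - x|} (by simp [spectralEvents]))
    have hup : mass (fun k => ∑ x ∈ Λ, p x k) (v ⁻¹' {v | ∀ x ∈ Λ, Δ / 4 ≤ |v - x|}) ≤ δ / 64 := by
      rw [mass_sum]
      exact (Finset.sum_le_sum fun y hy => mass_mono (F := {k | Δ / 4 ≤ |v k - y|}) (hp y)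
        fun k (hk : ∀ x ∈ Λ, Δ / 4 ≤ |v k - x|) => hk y hy).trans hfarsum
    linarith
  · have hev := abs_le.mp (hz {v | |v - x| ≤ min (ε / 2) (Δ / 16)} (by
      simp only [spectralEvents, Finset.mem_union, Finset.mem_image]
      exact Or.inl (Or.inr ⟨x, hx, rfl⟩)))
    have h1 := mass_add_mass_compl (p x) (v ⁻¹' {v | |v - x| ≤ min (ε / 2) (Δ / 16)})
    have h2 : mass (p x) (v ⁻¹' {v | |v - x| ≤ min (ε / 2) (Δ / 16)})ᶜ ≤
        mass (p x) {k | min (ε / 2) (Δ / 16) ≤ |v k - x|} := by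
      refine mass_mono (hp x) fun k hk => ?_
      simp only [Set.mem_compl_iff, Set.mem_preimage, Set.mem_ofPred_eq, not_le] at hk ⊢
      exact hk.le
    rw [hpw x hx] at h1
    linarith [hpeak x hx, hsingle x hx (v ⁻¹' {v | |v - x| ≤ min (ε / 2) (Δ / 16)})]

end Mixture

/-! ### The matrix of a network -/

namespace OscillatorNetwork

variable {V : Type} [Fintype V] [DecidableEq V] (S : OscillatorNetwork V)

theorem hamiltonian_apply (u v : V) : S.hamiltonian u v =
    (Real.sqrt (S.mass u))⁻¹ * S.stiffness u v * (Real.sqrt (S.mass v))⁻¹ := by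
  simp [hamiltonian, massInvSqrt]

theorem stiffness_symm (u v : V) : S.stiffness u v = S.stiffness v u := by
  by_cases h : u = v
  · rw [h]
  · simp only [stiffness, Matrix.of_apply, if_neg h, if_neg (Ne.symm h), S.spring_symm u v]
    classical exact if_congr (S.graph.adj_comm u v) rfl rfl

theorem hamiltonian_symm (u v : V) : S.hamiltonian u v = S.hamiltonian v u := by
  rw [hamiltonian_apply, hamiltonian_apply, S.stiffness_symm u v]
  ring

theorem hamiltonian_eq_zero {s : ℕ} {nbhd : V → Finset V} (h : S.IsPaddedNeighborhood s nbhd)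
    {u v : V} (hv : v ∉ nbhd u) : S.hamiltonian u v = 0 := by
  have h1 : u ≠ v := fun e => hv (e ▸ (h u).1)
  have h2 : ¬S.graph.Adj u v := fun e => hv ((h u).2.1 v e)
  simp [hamiltonian_apply, stiffness, h1, h2]

/-- Twice the potential energy is a sum of squares: the wall terms, and half the sum over all
ordered pairs of c_uv (x_u − x_v)². -/
theorem stiffness_quadratic_nonneg (x : V → ℝ) :
    0 ≤ ∑ u, ∑ v, x u * S.stiffness u v * x v := by
  classical
  set c : V → V → ℝ := fun u v => if S.graph.Adj u v then S.spring u v else 0 with hc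
  have hc0 : ∀ u v, 0 ≤ c u v := fun u v => by
    simp only [hc]
    split_ifs with h
    · exact (S.spring_pos u v h).le
    · exact le_rfl
  have hcs : ∀ u v, c u v = c v u := fun u v => by
    simp only [hc, S.graph.adj_comm u v, S.spring_symm u v]
  have hrow : ∀ u, ∑ v, x u * S.stiffness u v * x v =
      S.wall u * x u ^ 2 + ∑ v, c u v * (x u ^ 2 - x u * x v) := by
    intro u
    -- Since c_uu = 0, the stiffness matrix is a diagonal matrix minus `c`, with no case distinction
    -- left in the second term.
    have hK : ∀ v, S.stiffness u v = (if u = v then S.wall u + ∑ w, c u w else 0) - c u v := by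
      intro v
      by_cases h : u = v
      · subst h
        simp only [stiffness, Matrix.of_apply, if_true, hc, SimpleGraph.irrefl, if_false, sub_zero,
          Finset.sum_filter]
        simp only [S.spring_symm _ u]
      · simp only [stiffness, Matrix.of_apply, h, if_false, hc]
        split_ifs <;> simp
    simp only [hK, mul_sub, sub_mul, Finset.sum_sub_distrib, mul_ite, ite_mul, mul_zero, zero_mul,
      Finset.sum_ite_eq, Finset.mem_univ, if_true, ← Finset.sum_mul]
    rw [mul_add, add_mul, sub_eq_iff_eq_add]
    have : ∑ v, x u * c u v * x v = ∑ v, c u v * (x u * x v) :=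
      Finset.sum_congr rfl fun v _ => by ring
    rw [this]
    ring
  have hsym : ∑ u, ∑ v, c u v * (x u ^ 2 - x u * x v) =
      1 / 2 * ∑ u, ∑ v, c u v * (x u - x v) ^ 2 := by
    have hswap : ∑ u, ∑ v, c u v * (x u ^ 2 - x u * x v) =
        ∑ u, ∑ v, c u v * (x v ^ 2 - x u * x v) := by
      rw [Finset.sum_comm]
      refine Finset.sum_congr rfl fun u _ => Finset.sum_congr rfl fun v _ => ?_
      rw [hcs u v]; ring
    have hadd : ∑ u, ∑ v, c u v * (x u - x v) ^ 2 = ∑ u, ∑ v, c u v * (x u ^ 2 - x u * x v) +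
        ∑ u, ∑ v, c u v * (x v ^ 2 - x u * x v) := by
      simp only [← Finset.sum_add_distrib]
      exact Finset.sum_congr rfl fun u _ => Finset.sum_congr rfl fun v _ => by ring
    rw [hadd, ← hswap]; ring
  rw [Finset.sum_congr rfl fun u _ => hrow u, Finset.sum_add_distrib, hsym]
  refine add_nonneg (Finset.sum_nonneg fun u _ => mul_nonneg (S.wall_nonneg u) (sq_nonneg _)) ?_
  exact mul_nonneg (by norm_num) (Finset.sum_nonneg fun u _ => Finset.sum_nonneg fun v _ =>
    mul_nonneg (hc0 u v) (sq_nonneg _))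

theorem hamiltonian_quadratic_nonneg (x : V → ℝ) :
    0 ≤ ∑ u, ∑ v, x u * S.hamiltonian u v * x v := by
  refine (S.stiffness_quadratic_nonneg fun u => x u * (Real.sqrt (S.mass u))⁻¹).trans_eq ?_
  refine Finset.sum_congr rfl fun u _ => Finset.sum_congr rfl fun v _ => ?_
  rw [hamiltonian_apply]; ring

/-- Schur's test: |x_u x_v| ≤ (x_u² + x_v²)/2, and by sparsity each row has absolute sum at most s
b. -/
theorem hamiltonian_quadratic_le {s : ℕ} {nbhd : V → Finset V}
    (h : S.IsPaddedNeighborhood s nbhd) {b : ℝ} (hb : ∀ u v, |S.hamiltonian u v| ≤ b) (x : V → ℝ) :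
    ∑ u, ∑ v, x u * S.hamiltonian u v * x v ≤ s * b * ∑ u, x u ^ 2 := by
  have hrow : ∀ u, ∑ v, |S.hamiltonian u v| ≤ s * b := fun u => by
    rw [← Finset.sum_subset (Finset.subset_univ (nbhd u)) fun v _ hv => by
      rw [S.hamiltonian_eq_zero h hv, abs_zero], ← (h u).2.2, ← nsmul_eq_mul]
    exact Finset.sum_le_card_nsmul _ _ _ fun v _ => hb u v
  have hswap : ∑ u, ∑ v, |S.hamiltonian u v| * x v ^ 2 =
      ∑ u, ∑ v, |S.hamiltonian u v| * x u ^ 2 := by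
    rw [Finset.sum_comm]
    simp only [S.hamiltonian_symm]
  have hsplit : ∑ u, ∑ v, x u * S.hamiltonian u v * x v ≤
      1 / 2 * (∑ u, ∑ v, |S.hamiltonian u v| * x u ^ 2 +
        ∑ u, ∑ v, |S.hamiltonian u v| * x v ^ 2) := by
    simp only [← Finset.sum_add_distrib, Finset.mul_sum]
    refine Finset.sum_le_sum fun u _ => Finset.sum_le_sum fun v _ => ?_
    have h1 : x u * S.hamiltonian u v * x v ≤ |S.hamiltonian u v| * |x u * x v| := by
      rw [← abs_mul]
      exact (le_of_eq (by ring)).trans (le_abs_self _)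
    have h2 : |x u * x v| ≤ (x u ^ 2 + x v ^ 2) / 2 := by
      rw [abs_le]
      constructor <;> nlinarith [sq_nonneg (x u - x v), sq_nonneg (x u + x v)]
    linarith [mul_le_mul_of_nonneg_left h2 (abs_nonneg (S.hamiltonian u v))]
  rw [hswap] at hsplit
  refine hsplit.trans ?_
  rw [Finset.mul_sum, ← two_mul, ← mul_assoc]
  norm_num
  refine Finset.sum_le_sum fun u _ => ?_
  rw [← Finset.sum_mul]
  exact mul_le_mul_of_nonneg_right (hrow u) (sq_nonneg _)

end OscillatorNetwork

theorem abs_le_maxNorm {V : Type} [Finite V] (H : Matrix V V ℝ) (u v : V) : |H u v| ≤ maxNorm H :=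
  le_ciSup (f := fun p : V × V => |H p.1 p.2|) (Set.finite_range _).bddAbove (u, v)

/-! ### Spectral decomposition of a basis vector -/

section SpectralDecomposition

variable {V : Type} [Fintype V] [DecidableEq V] {H W : Matrix V V ℝ} {lam : V → ℝ}

open Classical in
/-- The component of the vertex `u` in the eigenspace of `x`. -/
noncomputable def eigenComponent (W : Matrix V V ℝ) (lam : V → ℝ) (u : V) (x : ℝ) : V → ℂ :=
  fun v => ((∑ j with lam j = x, W u j * W v j : ℝ) : ℂ)

theorem mul_transpose_eq_one (hW : W ∈ Matrix.orthogonalGroup V ℝ) : W * Wᵀ = 1 :=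
  (Matrix.mem_orthogonalGroup_iff V ℝ).mp hW

theorem transpose_mul_eq_one (hW : W ∈ Matrix.orthogonalGroup V ℝ) : Wᵀ * W = 1 :=
  (Matrix.mem_orthogonalGroup_iff' V ℝ).mp hW

/-- This expands the basis vector in the columns of `W`. Columns whose eigenvalue is not supported
at `u` have `W u j = 0` and contribute nothing. -/
theorem sum_eigenComponent (hW : W ∈ Matrix.orthogonalGroup V ℝ) (u : V) :
    ∑ x ∈ supportedEigenvalues W lam u, eigenComponent W lam u x = ket u := by
  classical
  ext v
  have h1 : ∑ x ∈ supportedEigenvalues W lam u, ∑ j with lam j = x, W u j * W v j =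
      (1 : Matrix V V ℝ) u v := by
    rw [← mul_transpose_eq_one hW, Matrix.mul_apply]
    simp only [Finset.sum_filter]
    rw [Finset.sum_comm]
    refine Finset.sum_congr rfl fun j _ => ?_
    rw [Finset.sum_ite_eq]
    split_ifs with hj
    · rfl
    · have : W u j = 0 := by
        by_contra hne
        exact hj (Finset.mem_image.mpr ⟨j, by simp [sq_pos_iff, hne], rfl⟩)
      simp [this]
  rw [Finset.sum_apply]
  simp only [eigenComponent]
  rw [← Complex.ofReal_sum, h1, Matrix.one_apply, ket, Pi.single_apply]
  simp only [eq_comm (a := v)]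
  split_ifs <;> simp

theorem mulVec_eigenComponent (hW : W ∈ Matrix.orthogonalGroup V ℝ)
    (hH : Wᵀ * H * W = Matrix.diagonal lam) (u : V) (x c : ℝ) :
    (Matrix.of fun v w => ((H v w / c : ℝ) : ℂ)) *ᵥ eigenComponent W lam u x =
      ((x / c : ℝ) : ℂ) • eigenComponent W lam u x := by
  classical
  have hHW : H * W = W * Matrix.diagonal lam := by
    rw [← hH, ← Matrix.mul_assoc, ← Matrix.mul_assoc, mul_transpose_eq_one hW, Matrix.one_mul]
  ext v
  have h1 : ∑ w, H v w / c * ∑ j with lam j = x, W u j * W w j =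
      x / c * ∑ j with lam j = x, W u j * W v j := by
    simp only [Finset.mul_sum]
    rw [Finset.sum_comm]
    refine Finset.sum_congr rfl fun j hj => ?_
    have h2 := congrFun (congrFun hHW v) j
    rw [Matrix.mul_apply, Matrix.mul_diagonal, (Finset.mem_filter.mp hj).2] at h2
    calc ∑ w, H v w / c * (W u j * W w j) = W u j / c * ∑ w, H v w * W w j := by
          rw [Finset.mul_sum]
          exact Finset.sum_congr rfl fun w _ => by ring
      _ = _ := by rw [h2]; ring
  simp only [Matrix.mulVec, dotProduct, Matrix.of_apply, eigenComponent, Pi.smul_apply,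
    smul_eq_mul]
  exact_mod_cast h1

theorem normSq_eigenComponent (hW : W ∈ Matrix.orthogonalGroup V ℝ) (u : V) (x : ℝ) :
    normSq (eigenComponent W lam u x) = weight W lam u x := by
  classical
  simp only [normSq, eigenComponent, Complex.norm_real, Real.norm_eq_abs, sq_abs, weight]
  have h1 : ∀ i j, ∑ v, W v i * W v j = if i = j then 1 else 0 := fun i j => by
    have := congrFun (congrFun (transpose_mul_eq_one hW) i) j
    rwa [Matrix.mul_apply, Matrix.one_apply] at this
  calc ∑ v, (∑ j with lam j = x, W u j * W v j) ^ 2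
      = ∑ v, ∑ i with lam i = x, ∑ j with lam j = x, W u i * W u j * (W v i * W v j) := by
        refine Finset.sum_congr rfl fun v _ => ?_
        rw [sq, Finset.sum_mul_sum]
        exact Finset.sum_congr rfl fun i _ => Finset.sum_congr rfl fun j _ => by ring
    _ = ∑ i with lam i = x, ∑ j with lam j = x, W u i * W u j * if i = j then 1 else 0 := by
        rw [Finset.sum_comm]
        refine Finset.sum_congr rfl fun i _ => ?_
        rw [Finset.sum_comm]
        refine Finset.sum_congr rfl fun j _ => ?_
        rw [← Finset.mul_sum, h1]
    _ = _ := by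
        refine Finset.sum_congr rfl fun i hi => ?_
        simp only [mul_ite, mul_one, mul_zero]
        rw [Finset.sum_ite_eq, if_pos hi, sq]

end SpectralDecomposition

/-! ### Accuracy of the estimate -/

section Accuracy

variable {n r m s : ℕ}

theorem measured_sum {Y ι : Type*} [Fintype Y] [DecidableEq Y] {M : ℕ}
    (V : Matrix (Fin M) (Fin M) ℂ) (a : ℕ → ℝ) (Q : Matrix Y Y ℂ) (I : Finset ι) (ψ : ι → Y → ℂ)
    (k : Fin M) :
    measured V a Q (∑ x ∈ I, ψ x) k = ∑ x ∈ I, measured V a Q (ψ x) k := by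
  simp only [measured, Matrix.mulVec_sum, Finset.smul_sum]
  exact Finset.sum_comm

/-- The left side is 2π²/M², and π² ≤ 10. -/
theorem sineWindow_moment_le {M : ℕ} (hM : 0 < M) :
    M * (Real.sqrt (2 / M) * (Real.pi / M)) ^ 2 ≤ 20 / (M : ℝ) ^ 2 := by
  have hM' : (0 : ℝ) < M := by exact_mod_cast hM
  rw [mul_pow, Real.sq_sqrt (by positivity), div_pow]
  have hpi : Real.pi ^ 2 ≤ 10 := by nlinarith [Real.pi_lt_d2, Real.pi_pos]
  have : (M : ℝ) * (2 / M * (Real.pi ^ 2 / (M : ℝ) ^ 2)) = 2 * Real.pi ^ 2 / (M : ℝ) ^ 2 := by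
    field_simp
  rw [this]
  gcongr
  linarith

/-- The oracles of a network encode its matrix. -/
theorem exists_encodes {dec : Bits r → ℝ} {S : OscillatorNetwork (Bits n)}
    {nbhd : Bits n → Finset (Bits n)} (hS : S.IsPaddedNeighborhood s nbhd)
    (hpos : 0 < maxNorm S.hamiltonian) {OP : Matrix.unitaryGroup (PosBasis n) ℂ}
    {OA : Matrix.unitaryGroup (AngleBasis n r) ℂ} (hOP : IsPositionOracle s nbhd OP)
    (hOA : IsAngleOracle dec S.hamiltonian OA) :
    ∃ θ, Encodes dec s nbhd (fun u v => S.hamiltonian u v / maxNorm S.hamiltonian) θ OP OA := by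
  obtain ⟨θ, hθ, hOA⟩ := hOA
  refine ⟨fun u v => (θ u v, decide (S.hamiltonian u v < 0)), hOP, hOA, fun u v => ?_,
    fun u v => by rw [S.hamiltonian_symm u v],
    fun u v hv => by rw [S.hamiltonian_eq_zero hS hv, zero_div]⟩
  have hle : |S.hamiltonian u v| / maxNorm S.hamiltonian ≤ 1 :=
    (div_le_one hpos).mpr (abs_le_maxNorm _ u v)
  have h0 := Real.sqrt_nonneg (|S.hamiltonian u v| / maxNorm S.hamiltonian)
  rw [entryValue, hθ, Real.cos_arccos (by linarith) (Real.sqrt_le_one.mpr hle),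
    Real.sq_sqrt (by positivity)]
  by_cases h : S.hamiltonian u v < 0
  · simp [h, abs_of_neg h, neg_div]
  · simp [h, abs_of_nonneg (not_lt.mp h)]

variable {dec : Bits r → ℝ} {u : Bits n} {S : OscillatorNetwork (Bits n)}
  {nbhd : Bits n → Finset (Bits n)} {W : Matrix (Bits n) (Bits n) ℝ} {lam : Bits n → ℝ}
  {OP : Matrix.unitaryGroup (PosBasis n) ℂ} {OA : Matrix.unitaryGroup (AngleBasis n r) ℂ}
  {G : Matrix.unitaryGroup (WalkBasis n r) ℂ}

theorem isWalkVector_eigenComponent (hS : S.IsPaddedNeighborhood s nbhd)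
    (hpos : 0 < maxNorm S.hamiltonian) (hW : W ∈ Matrix.orthogonalGroup (Bits n) ℝ)
    (hH : Wᵀ * S.hamiltonian * W = Matrix.diagonal lam) (hOP : IsPositionOracle s nbhd OP)
    (hOA : IsAngleOracle dec S.hamiltonian OA)
    (hG : ∀ p : AngleBasis n r, (G : Matrix (WalkBasis n r) (WalkBasis n r) ℂ) *ᵥ ket (false, p) =
      tens (flagState (entryValue dec p.2)) (ket p)) (x : ℝ) :
    IsWalkVector (walk G OP OA) (embed n r *ᵥ eigenComponent W lam u x)
      (x / (s * maxNorm S.hamiltonian)) := by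
  obtain ⟨θ, he⟩ := exists_encodes hS hpos hOP hOA
  refine isWalkVector_reflection_mul embed_isometry conjTranspose_blockEncoding
    blockEncoding_mul_self ?_
  rw [embed_compress_blockEncoding he hG, ← mulVec_eigenComponent hW hH]
  simp only [div_div, mul_comm]

/-- The distribution of the measured clock is a mixture over the eigenvalues at `u`. -/
theorem normSq_measured_origin (hS : S.IsPaddedNeighborhood s nbhd)
    (hpos : 0 < maxNorm S.hamiltonian) (hs : 0 < s) (hW : W ∈ Matrix.orthogonalGroup (Bits n) ℝ)
    (hH : Wᵀ * S.hamiltonian * W = Matrix.diagonal lam) (hOP : IsPositionOracle s nbhd OP)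
    (hOA : IsAngleOracle dec S.hamiltonian OA)
    (hG : ∀ p : AngleBasis n r, (G : Matrix (WalkBasis n r) (WalkBasis n r) ℂ) *ᵥ ket (false, p) =
      tens (flagState (entryValue dec p.2)) (ket p)) {M : ℕ} (V : Matrix (Fin M) (Fin M) ℂ)
    (a : ℕ → ℝ) (k : Fin M) :
    normSq (measured V a (walk G OP OA) (ket (origin n r u)) k) =
      ∑ x ∈ supportedEigenvalues W lam u,
        normSq (measured V a (walk G OP OA) (embed n r *ᵥ eigenComponent W lam u x) k) := by
  rw [← embed_mulVec_ket, ← sum_eigenComponent hW (lam := lam), Matrix.mulVec_sum, measured_sum]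
  have hw := fun x => isWalkVector_eigenComponent (u := u) hS hpos hW hH hOP hOA hG x
  have hherm : (walk G OP OA + (walk G OP OA)ᴴ).IsHermitian := by
    rw [Matrix.IsHermitian, Matrix.conjTranspose_add, Matrix.conjTranspose_conjTranspose, add_comm]
  have hs' : (0 : ℝ) < s := by exact_mod_cast hs
  refine normSq_sum_of_orthogonal _ _ fun x _ y _ hxy => dotProduct_eq_zero_of_eigenvalue_ne hherm
    ((hw x).eigen_measured V a k) ((hw y).eigen_measured V a k) fun h => hxy ?_
  have hL : (s * maxNorm S.hamiltonian) ≠ 0 := by positivity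
  exact (div_left_inj' hL).mp (mul_left_cancel₀ two_ne_zero h)

/-- The success probability of phase estimation. -/
theorem phaseEstimator_prob {R : ℕ} (hR : 0 < R) (hm : 0 < m) (hS : S.IsPaddedNeighborhood s nbhd)
    (hpos : 0 < maxNorm S.hamiltonian) (hs : 0 < s) (hW : W ∈ Matrix.orthogonalGroup (Bits n) ℝ)
    (hH : Wᵀ * S.hamiltonian * W = Matrix.diagonal lam) (hOP : IsPositionOracle s nbhd OP)
    (hOA : IsAngleOracle dec S.hamiltonian OA)
    (hG : ∀ p : AngleBasis n r, (G : Matrix (WalkBasis n r) (WalkBasis n r) ℂ) *ᵥ ket (false, p) =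
      tens (flagState (entryValue dec p.2)) (ket p))
    {V : Matrix.unitaryGroup (Fin (2 ^ m)) ℂ} {ξ : Fin (2 ^ m) → ℝ}
    (hξ : (V : Matrix (Fin (2 ^ m)) (Fin (2 ^ m)) ℂ)ᴴ * pathMatrix (2 ^ m) =
      Matrix.diagonal (fun t => (ξ t : ℂ)) * (V : Matrix (Fin (2 ^ m)) (Fin (2 ^ m)) ℂ)ᴴ)
    {prep : Matrix.unitaryGroup (Basis n r (m + 1)) ℂ}
    (hprep : (prep : Matrix (Basis n r (m + 1)) (Basis n r (m + 1)) ℂ) *ᵥ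
      ket (((zeros n, zeros n), (zeros r, false)), zeros (m + 1)) =
        initialState n r m u (sineWindow (2 ^ m)))
    {Δ ε δ : ℝ} (hε : 0 < ε) (hδ : 0 < δ) (hδ1 : δ < 1) (hΔ : IsLeast (gaps W lam u) Δ)
    (hβ₁ : (s * maxNorm S.hamiltonian) ^ 2 * (20 / (2 ^ m) ^ 2) ≤ δ / 64 * (Δ / 4) ^ 2)
    (hβ₂ : (s * maxNorm S.hamiltonian) ^ 2 * (20 / (2 ^ m) ^ 2) ≤
      1 / 4 * min (ε / 2) (Δ / 16) ^ 2) :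
    1 - (2 * (supportedEigenvalues W lam u).card + 1 : ℕ) *
        (2 * Real.exp (-(R * (δ / 64) ^ 2 / 4))) ≤
      (phaseEstimator m R G V prep fun z => estimate Δ ε δ fun i =>
        s * maxNorm S.hamiltonian * ξ (z i)).prob OP OA (IsAccurate W lam u ε δ) := by
  classical
  set A := phaseEstimator m R G V prep fun z => estimate Δ ε δ fun i =>
    s * maxNorm S.hamiltonian * ξ (z i)
  set L : ℝ := s * maxNorm S.hamiltonian with hL
  have hs' : (0 : ℝ) < s := by exact_mod_cast hs
  have hL0 : 0 < L := by positivity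
  set Λ := supportedEigenvalues W lam u
  set a := sineWindow (2 ^ m)
  set Q := walk G OP OA with hQ
  -- `0 < m` makes the number of times even, as the pairing in `sum_sineWindow_sq` requires.
  have ha : ∑ t : Fin (2 ^ m), a t ^ 2 = 1 := by
    obtain ⟨m', rfl⟩ := Nat.exists_eq_succ_of_ne_zero hm.ne'
    have := sum_sineWindow_sq (K := 2 ^ m') (by positivity)
    rwa [← pow_succ'] at this
  have hw := fun x => isWalkVector_eigenComponent (u := u) hS hpos hW hH hOP hOA hG x
  set p : ℝ → Fin (2 ^ m) → ℝ := fun x k =>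
    normSq (measured V a Q (embed n r *ᵥ eigenComponent W lam u x) k) with hp
  have hQu : Q ∈ Matrix.unitaryGroup (WalkBasis n r) ℂ := (hw 0).unitary
  have hpw : ∀ x, ∑ k, p x k = weight W lam u x := fun x => by
    rw [← normSq_eigenComponent hW, ← normSq_isometry_mulVec (embed_isometry (r := r))]
    exact sum_normSq_measured hQu _ V.2 ha
  have hmix : ∀ k, normSq (measured V a Q (ket (origin n r u)) k) = ∑ x ∈ Λ, p x k := fun k =>
    normSq_measured_origin hS hpos hs hW hH hOP hOA hG _ a k
  have htot : ∑ k, ∑ x ∈ Λ, p x k = 1 := by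
    rw [← normSq_ket (origin n r u), ← sum_normSq_measured hQu (ket (origin n r u)) V.2 ha]
    exact Finset.sum_congr rfl fun k _ => (hmix k).symm
  have hwsum : ∑ x ∈ Λ, weight W lam u x = 1 := by
    rw [← htot, Finset.sum_comm]
    exact Finset.sum_congr rfl fun x _ => (hpw x).symm
  have hmom : ∀ x ∈ Λ, ∑ k, (L * ξ k - x) ^ 2 * p x k ≤
      L ^ 2 * (20 / (2 ^ m) ^ 2) * weight W lam u x := fun x _ => by
    have h1 := (hw x).second_moment V.2 hξ (sineWindow_zero _) (sineWindow_self _)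
      (fun t _ => abs_sineWindow_succ_sub_le (2 ^ m) t)
    have h2 := sineWindow_moment_le (M := 2 ^ m) (by positivity)
    rw [normSq_isometry_mulVec embed_isometry, normSq_eigenComponent hW] at h1
    have hw0 : 0 ≤ weight W lam u x := Finset.sum_nonneg fun j _ => sq_nonneg _
    have h3 := h1.trans (mul_le_mul_of_nonneg_right h2 hw0)
    calc ∑ k, (L * ξ k - x) ^ 2 * p x k = L ^ 2 * ∑ k, (ξ k - x / L) ^ 2 * p x k := by
          rw [Finset.mul_sum]
          refine Finset.sum_congr rfl fun k _ => ?_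
          field_simp
      _ ≤ _ := by
          rw [mul_assoc]
          push_cast at h3
          exact mul_le_mul_of_nonneg_left h3 (sq_nonneg _)
  have hΔ0 : 0 < Δ := by
    obtain ⟨i, j, h1, h2, -⟩ := hΔ.1
    rwa [h1]
  have hgap : ∀ x ∈ Λ, ∀ x' ∈ Λ, |x - x'| < Δ → x = x' := by
    intro x hx x' hx' hlt
    obtain ⟨i, hi, rfl⟩ := Finset.mem_image.mp hx
    obtain ⟨j, hj, rfl⟩ := Finset.mem_image.mp hx'
    by_contra hne
    exact absurd (hΔ.2 ⟨i, j, rfl, abs_pos.mpr (sub_ne_zero.mpr hne),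
      (Finset.mem_filter.mp hi).2, (Finset.mem_filter.mp hj).2⟩) (not_le.mpr hlt)
  set f : Basis n r (m + 1) → ℝ := fun b => L * ξ (basisEquiv n r m b).2 with hf
  set P : Basis n r (m + 1) → ℝ := fun b => ‖A.finalState OP OA b‖ ^ 2 with hP
  -- The registers other than the clock are summed out, and the clock follows the mixture.
  have hPsum : ∀ g : Fin (2 ^ m) → ℝ, ∑ b, P b * g (basisEquiv n r m b).2 =
      ∑ k, (∑ x ∈ Λ, p x k) * g k := by
    intro g
    have h1 : ∀ b, P b = ‖glue (measured V a Q (ket (origin n r u))) (basisEquiv n r m b)‖ ^ 2 :=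
      fun b => congrArg (fun ψ : Basis n r (m + 1) → ℂ => ‖ψ b‖ ^ 2)
        (phaseEstimator_finalState G OP OA R V _ hprep)
    simp only [h1]
    refine (sum_comp_basisEquiv fun z =>
      ‖glue (measured V a Q (ket (origin n r u))) z‖ ^ 2 * g z.2).trans ?_
    refine Finset.sum_congr rfl fun k _ => ?_
    rw [← hmix]
    exact (Finset.sum_mul Finset.univ
      (fun y => ‖measured V a Q (ket (origin n r u)) k y‖ ^ 2) (g k)).symm
  have hP1 : ∑ b, P b = 1 := by
    have := hPsum fun _ => 1
    simp only [mul_one] at this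
    rw [this, htot]
  have hconc := one_sub_le_sum_freq_close (R := R) (p := P) (fun b => sq_nonneg _) hP1 hR
    ((spectralEvents Δ ε Λ).image fun E => f ⁻¹' E) (τ := δ / 64) (by positivity) (by linarith)
  have hcard : (((spectralEvents Δ ε Λ).image fun E => f ⁻¹' E).card : ℝ) ≤
      (2 * Λ.card + 1 : ℕ) := by
    exact_mod_cast Finset.card_image_le.trans (card_spectralEvents_le Δ ε Λ)
  refine le_trans ?_ (hconc.trans ?_)
  · have := mul_le_mul_of_nonneg_right hcard
      (by positivity : 0 ≤ 2 * Real.exp (-(R * (δ / 64) ^ 2 / 4)))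
    linarith
  · refine Finset.sum_le_sum_of_subset_of_nonneg ?_
      fun y _ _ => Finset.prod_nonneg fun i _ => sq_nonneg _
    intro y hy
    have hy := (Finset.mem_filter.mp hy).2
    refine Finset.mem_filter.mpr ⟨Finset.mem_univ _, isAccurate_estimate hδ ?_⟩
    refine consistent_of_freq_close (v := fun k => L * ξ k) (p := p) hΔ0 hε hgap
      (fun x k => normSq_nonneg _) (fun x _ => hpw x) hwsum hmom hβ₁ hβ₂ fun E hE => ?_
    have h1 := hy _ (Finset.mem_image_of_mem _ hE)
    have h2 : mass P (f ⁻¹' E) =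
        mass (fun k => ∑ x ∈ Λ, p x k) ((fun k => L * ξ k) ⁻¹' E) :=
      hPsum (((fun k => L * ξ k) ⁻¹' E).indicator fun _ => (1 : ℝ))
    rw [h2] at h1
    exact h1

end Accuracy

/-! ### Choice of the parameters -/

section Parameters

/-- The factor 256 is what `moment_bounds` asks of the number of times; rounding up to a power of
two costs at most a factor 2. -/
theorem clock_size_bounds {q : ℝ} (hq : 1 ≤ q) :
    256 * q ≤ 2 ^ (⌈Real.logb 2 (128 * q)⌉₊ + 1) ∧
      (2 : ℝ) ^ (⌈Real.logb 2 (128 * q)⌉₊ + 1) ≤ 512 * q ∧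
      ((⌈Real.logb 2 (128 * q)⌉₊ + 1 : ℕ) : ℝ) ≤ 9 + Real.logb 2 q := by
  have hq0 : (0 : ℝ) < q := by linarith
  have hlog : Real.logb 2 (128 * q) = 7 + Real.logb 2 q := by
    rw [Real.logb_mul (by norm_num) hq0.ne', show (128 : ℝ) = 2 ^ (7 : ℝ) by norm_num,
      Real.logb_rpow (by norm_num) (by norm_num)]
  have hnn : 0 ≤ Real.logb 2 (128 * q) := by
    rw [hlog]; linarith [Real.logb_nonneg (b := 2) (by norm_num) hq]
  have hpow : (2 : ℝ) ^ Real.logb 2 (128 * q) = 128 * q :=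
    Real.rpow_logb (by norm_num) (by norm_num) (by positivity)
  have h1 := Nat.le_ceil (Real.logb 2 (128 * q))
  have h2 := (Nat.ceil_lt_add_one hnn).le
  set c := ⌈Real.logb 2 (128 * q)⌉₊
  have hlow : 128 * q ≤ 2 ^ c := by
    rw [← hpow, ← Real.rpow_natCast]
    exact Real.rpow_le_rpow_of_exponent_le (by norm_num) h1
  have hup : (2 : ℝ) ^ c ≤ 128 * q * 2 := by
    rw [← hpow, ← Real.rpow_natCast, ← Real.rpow_add_one (by norm_num)]
    exact Real.rpow_le_rpow_of_exponent_le (by norm_num) h2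
  refine ⟨by rw [pow_succ]; linarith, by rw [pow_succ]; linarith, ?_⟩
  push_cast
  linarith

/-- The exponent is Rδ²/2^14, so the constant 2^16 turns the exponential into at most (ζ/N)^4. The
fourth power absorbs the factor 2(2N + 1) of the union bound because N ≥ 2. -/
theorem failure_le {N R : ℕ} (hN : 2 ≤ N) {ζ δ : ℝ} (hζ : 0 < ζ) (hζ1 : ζ < 1) (hδ : 0 < δ)
    (hR : 2 ^ 16 * Real.log (N / ζ) / δ ^ 2 ≤ R) :
    (2 * N + 1 : ℕ) * (2 * Real.exp (-(R * (δ / 64) ^ 2 / 4))) ≤ ζ := by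
  have hN' : (2 : ℝ) ≤ N := by exact_mod_cast hN
  have hexp : Real.exp (-(R * (δ / 64) ^ 2 / 4)) ≤ (ζ / N) ^ 4 := by
    rw [← Real.exp_log (by positivity : 0 < (ζ / N) ^ 4), Real.log_pow,
      ← inv_div (N : ℝ) ζ, Real.log_inv]
    refine Real.exp_le_exp.mpr ?_
    rw [div_le_iff₀ (by positivity)] at hR
    push_cast
    nlinarith
  have hζ4 : ζ ^ 4 ≤ ζ := pow_le_of_le_one hζ.le hζ1.le (by norm_num)
  have hN4 : 2 * (2 * (N : ℝ) + 1) ≤ N ^ 4 := by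
    have : (8 : ℝ) ≤ N ^ 3 := by nlinarith [sq_nonneg (N : ℝ)]
    nlinarith
  calc (2 * N + 1 : ℕ) * (2 * Real.exp (-(R * (δ / 64) ^ 2 / 4)))
      ≤ (2 * N + 1 : ℕ) * (2 * (ζ / N) ^ 4) := by gcongr
    _ = 2 * (2 * (N : ℝ) + 1) / N ^ 4 * ζ ^ 4 := by push_cast; rw [div_pow]; ring
    _ ≤ 1 * ζ ^ 4 := by
        gcongr
        exact (div_le_one (by positivity)).mpr hN4
    _ ≤ ζ := by linarith

/-- The number of times yields L/M ≤ ε/256 and L/M ≤ δΔ/256. This is not sharp: √δ Δ in place of δΔ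
would do. -/
theorem moment_bounds {L M Δ ε δ : ℝ} (hL : 0 < L) (hΔ : 0 < Δ) (hε : 0 < ε) (hδ : 0 < δ)
    (hδ1 : δ < 1) (hM : 256 * (L * max (1 / ε) (1 / (δ * Δ))) ≤ M) :
    L ^ 2 * (20 / M ^ 2) ≤ δ / 64 * (Δ / 4) ^ 2 ∧
      L ^ 2 * (20 / M ^ 2) ≤ 1 / 4 * min (ε / 2) (Δ / 16) ^ 2 := by
  have h1 : 256 * (L * (1 / ε)) ≤ M := le_trans (by gcongr; exact le_max_left _ _) hM
  have h2 : 256 * (L * (1 / (δ * Δ))) ≤ M := le_trans (by gcongr; exact le_max_right _ _) hM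
  have hM0 : 0 < M := lt_of_lt_of_le (by positivity) h1
  have e1 : L / M ≤ ε / 256 := by
    rw [mul_one_div, ← mul_div_assoc, div_le_iff₀ hε] at h1
    rw [div_le_div_iff₀ hM0 (by norm_num)]; linarith
  have e2 : L / M ≤ δ * Δ / 256 := by
    rw [mul_one_div, ← mul_div_assoc, div_le_iff₀ (by positivity)] at h2
    rw [div_le_div_iff₀ hM0 (by norm_num)]; linarith
  have e0 : 0 ≤ L / M := by positivity
  have hrw : L ^ 2 * (20 / M ^ 2) = 20 * (L / M) ^ 2 := by rw [div_pow]; ring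
  have f1 : (L / M) ^ 2 ≤ (ε / 256) ^ 2 := pow_le_pow_left₀ e0 e1 2
  have f2 : (L / M) ^ 2 ≤ (δ * Δ / 256) ^ 2 := pow_le_pow_left₀ e0 e2 2
  have f3 : δ ^ 2 * Δ ^ 2 ≤ δ * Δ ^ 2 :=
    mul_le_mul_of_nonneg_right (by nlinarith) (sq_nonneg _)
  have f4 : δ * Δ ^ 2 ≤ Δ ^ 2 := mul_le_of_le_one_left (sq_nonneg _) hδ1.le
  have f5 : 0 ≤ δ * Δ ^ 2 := by positivity
  rw [hrw]
  constructor
  · nlinarith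
  · rcases min_cases (ε / 2) (Δ / 16) with ⟨h, -⟩ | ⟨h, -⟩
    · rw [h]; nlinarith [sq_nonneg ε]
    · rw [h]; nlinarith [sq_nonneg Δ]

end Parameters

/-- The eigenvalues of a network lie between `0` and `s ‖H‖_max`. -/
theorem eigenvalue_mem_Icc {V : Type} [Fintype V] [DecidableEq V] {S : OscillatorNetwork V} {s : ℕ}
    {nbhd : V → Finset V} (hS : S.IsPaddedNeighborhood s nbhd) {W : Matrix V V ℝ} {lam : V → ℝ}
    (hW : W ∈ Matrix.orthogonalGroup V ℝ) (hH : Wᵀ * S.hamiltonian * W = Matrix.diagonal lam)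
    (j : V) : lam j ∈ Set.Icc 0 (s * maxNorm S.hamiltonian) := by
  have h1 : lam j = ∑ u, ∑ v, W u j * S.hamiltonian u v * W v j := by
    have := congrFun (congrFun hH j) j
    rw [Matrix.diagonal_apply_eq, Matrix.mul_apply] at this
    rw [← this, Finset.sum_comm]
    refine Finset.sum_congr rfl fun v _ => ?_
    rw [Matrix.mul_apply, Finset.sum_mul]
    rfl
  have h2 : ∑ u, W u j ^ 2 = 1 := by
    have := congrFun (congrFun (transpose_mul_eq_one hW) j) j
    rw [Matrix.mul_apply, Matrix.one_apply_eq] at this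
    simpa [sq] using this
  have h3 := S.hamiltonian_quadratic_le hS (fun u v => abs_le_maxNorm S.hamiltonian u v)
    fun u => W u j
  rw [h2, mul_one] at h3
  exact ⟨h1 ▸ S.hamiltonian_quadratic_nonneg _, h1 ▸ h3⟩

end ResponseQPE

/-! ### The main theorem: choice of the algorithm and resource count -/

open ResponseQPE in
theorem theorem1 :
    ∃ C : ℝ, 0 < C ∧
      ∀ (n r s Nu : ℕ) (dec : Bits r → ℝ) (u : Bits n) (hmax Δ ε δ ζ : ℝ),
        0 < ε → 0 < δ → δ < 1 → 0 < ζ → ζ < 1 →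
        -- the algorithm depends on these parameters only, not on the network
        ∃ A : QueryAlgorithm n r,
          ∀ (S : OscillatorNetwork (Bits n)) (nbhd : Bits n → Finset (Bits n))
            (W : Matrix (Bits n) (Bits n) ℝ) (lam : Bits n → ℝ),
            S.IsPaddedNeighborhood s nbhd →
            maxNorm S.hamiltonian = hmax →
            W ∈ Matrix.orthogonalGroup (Bits n) ℝ →
            W.transpose * S.hamiltonian * W = Matrix.diagonal lam →
            (supportedEigenvalues W lam u).card = Nu →
            IsLeast (gaps W lam u) Δ →
            (A.qubits : ℝ) ≤ (r + 1 : ℕ) +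
                C * Real.logb 2 (2 ^ n * s * hmax * max (1 / ε) (1 / (δ * Δ))) ∧
            (A.queries : ℝ) ≤
                C * (s * hmax / δ ^ 2 * Real.log (Nu / ζ) * max (1 / ε) (1 / (δ * Δ))) ∧
            ∀ (OP : Matrix.unitaryGroup (PosBasis n) ℂ)
              (OA : Matrix.unitaryGroup (AngleBasis n r) ℂ),
              IsPositionOracle s nbhd OP →
              IsAngleOracle dec S.hamiltonian OA →
              1 - ζ ≤ A.prob OP OA (IsAccurate W lam u ε δ) := by
  -- The query count dictates the constant: 2 · 2^16 for the runs and 2^12 for the steps of each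
  -- run. The qubit bound needs far less.
  refine ⟨2 ^ 29, by norm_num, fun n r s Nu dec u hmax Δ ε δ ζ hε hδ hδ1 hζ hζ1 => ?_⟩
  set μ := max (1 / ε) (1 / (δ * Δ)) with hμ
  -- The algorithm is fixed before the network; for parameters that no network has, the values of
  -- `m` and `R` are arbitrary but harmless.
  set m := ⌈Real.logb 2 (128 * (s * hmax * μ))⌉₊ + 1 with hm
  set R := ⌈2 ^ 16 * Real.log (Nu / ζ) / δ ^ 2⌉₊ with hR
  obtain ⟨G, hG⟩ := exists_flagRotation n dec
  obtain ⟨V, ξ, hξ⟩ := exists_unitary_diagonalizing (isHermitian_pathMatrix (2 ^ m))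
  have ha : ∑ t : Fin (2 ^ m), sineWindow (2 ^ m) t ^ 2 = 1 := by
    have := sum_sineWindow_sq (K := 2 ^ ⌈Real.logb 2 (128 * (s * hmax * μ))⌉₊) (by positivity)
    rwa [← pow_succ'] at this
  obtain ⟨prep, hprep⟩ := exists_unitary_mulVec_ket
    (((zeros n, zeros n), (zeros r, false)), zeros (m + 1)) (normSq_initialState (r := r) u ha)
  refine ⟨phaseEstimator m R G V prep fun z => estimate Δ ε δ fun i => s * hmax * ξ (z i),
    fun S nbhd W lam hS hmx hW hH hNu hΔ => ?_⟩
  subst hmx hNu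
  set L : ℝ := s * maxNorm S.hamiltonian with hL
  obtain ⟨⟨i, j, hij, hij0, hi, hj⟩, -⟩ := id hΔ
  have hΔ0 : 0 < Δ := hij ▸ hij0
  have hne : lam i ≠ lam j := fun h => by simp [h] at hij0
  have hΔL : Δ ≤ L := by
    have h1 := eigenvalue_mem_Icc hS hW hH i
    have h2 := eigenvalue_mem_Icc hS hW hH j
    rw [hij, abs_le]
    constructor <;> linarith [h1.1, h1.2, h2.1, h2.2]
  have hL0 : 0 < L := hΔ0.trans_le hΔL
  have hs : 0 < s := Nat.pos_of_ne_zero fun h => by simp [hL, h] at hL0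
  have hpos : 0 < maxNorm S.hamiltonian := pos_of_mul_pos_right hL0 (Nat.cast_nonneg s)
  -- Two different eigenvalues exclude a single oscillator; n ≥ 1 then absorbs the additive
  -- constants of the qubit count.
  have hn : 1 ≤ n := Nat.one_le_iff_ne_zero.mpr fun h => by
    subst h
    exact hne (congrArg lam (Subsingleton.elim i j))
  have hNu2 : 2 ≤ (supportedEigenvalues W lam u).card := by
    refine Finset.one_lt_card.mpr ⟨lam i, ?_, lam j, ?_, hne⟩ <;>
      exact Finset.mem_image_of_mem _ (Finset.mem_filter.mpr ⟨Finset.mem_univ _, by assumption⟩)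
  set N := (supportedEigenvalues W lam u).card
  have hN' : (2 : ℝ) ≤ N := by exact_mod_cast hNu2
  -- The spectrum lies in [0, L], so Δ ≤ L. Hence the logarithm is nonnegative, and rounding in `m`
  -- costs only a constant factor.
  have hq : 1 ≤ L * μ := by
    have h1 : 1 / Δ ≤ μ := le_trans (one_div_le_one_div_of_le (by positivity)
      (mul_le_of_le_one_left hΔ0.le hδ1.le)) (le_max_right _ _)
    calc 1 ≤ L * (1 / Δ) := by rw [mul_one_div, one_le_div hΔ0]; exact hΔL
      _ ≤ L * μ := mul_le_mul_of_nonneg_left h1 hL0.le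
  obtain ⟨hM1, hM2, hM3⟩ := clock_size_bounds hq
  rw [← hm] at hM1 hM2 hM3
  have hlog : 1 / 2 ≤ Real.log (N / ζ) := by
    refine le_trans ?_ (Real.log_le_log (by norm_num)
      (hN'.trans (le_div_self (by positivity) hζ hζ1.le)))
    linarith [Real.log_two_gt_d9]
  -- Thus rounding up to `R` at most doubles the number of runs.
  have hX : 1 ≤ 2 ^ 16 * Real.log (N / ζ) / δ ^ 2 := by
    rw [one_le_div (by positivity)]
    nlinarith
  refine ⟨?_, ?_, fun OP OA hOP hOA => ?_⟩
  · have hlogb : Real.logb 2 (2 ^ n * s * maxNorm S.hamiltonian * μ) = n + Real.logb 2 (L * μ) := by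
      rw [hL, mul_assoc (2 ^ n : ℝ), mul_assoc (2 ^ n : ℝ), Real.logb_mul (by positivity)
        (by rw [← hL]; positivity), Real.logb_pow, Real.logb_self_eq_one (by norm_num), mul_one]
    have hl0 : 0 ≤ Real.logb 2 (L * μ) := Real.logb_nonneg (by norm_num) hq
    have hn' : (1 : ℝ) ≤ n := by exact_mod_cast hn
    have hqb : (phaseEstimator m R G V prep fun z => estimate Δ ε δ fun i =>
        L * ξ (z i)).qubits = 2 * n + (r + 1) + (m + 1) := rfl
    rw [hqb, hlogb]
    push_cast at hM3 ⊢
    nlinarith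
  · rw [phaseEstimator_queries]
    have hRle : (R : ℝ) ≤ 2 * (2 ^ 16 * Real.log (N / ζ) / δ ^ 2) := by
      have := (Nat.ceil_lt_add_one (by linarith : 0 ≤ 2 ^ 16 * Real.log (N / ζ) / δ ^ 2)).le
      rw [← hR] at this
      linarith
    -- 6 · 2^m + 2 ≤ 8 · 2^m, and 2^m ≤ 512 Lμ.
    have hSt : (6 * 2 ^ m + 2 : ℝ) ≤ 2 ^ 12 * (L * μ) := by
      have : (1 : ℝ) ≤ 2 ^ m := one_le_pow₀ (by norm_num)
      linarith
    push_cast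
    calc (R : ℝ) * (6 * 2 ^ m + 2)
        ≤ 2 * (2 ^ 16 * Real.log (N / ζ) / δ ^ 2) * (2 ^ 12 * (L * μ)) := by gcongr
      _ = 2 ^ 29 * (L / δ ^ 2 * Real.log (N / ζ) * μ) := by ring
  · obtain ⟨hβ₁, hβ₂⟩ := moment_bounds hL0 hΔ0 hε hδ hδ1 hM1
    have hRpos : 0 < R := Nat.ceil_pos.mpr (by linarith)
    have h1 := phaseEstimator_prob (u := u) hRpos (Nat.succ_pos _) hS hpos hs hW hH hOP hOA hG hξ
      hprep hε hδ hδ1 hΔ hβ₁ hβ₂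
    exact (sub_le_sub_left (failure_le (R := R) hNu2 hζ hζ1 hδ (Nat.le_ceil _)) 1).trans h1
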